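/- **Standard oscillator groups.** Let $H\neq 0$ be a complex Hilbert space (inner product linear in the first argument), $U:\mathbb R\to \mathrm U(H)$, $U(t)=e^{itA}$, a strongly continuous unitary one-parameter group whose self-adjoint generator satisfies $A\ge 0$ and $\ker A=0$. Let $V_A=C^\infty(A)$ be the space of vectors $x\in H$ for which $t\mapsto U(t)x$ is smooth, with the $C^\infty$-topology (given by the seminorms $\|A^kx\|$, $k\ge 0$), and $\omega_A(x,y)=\operatorname{Im}\langle Ax,y\rangle$ on $V_A$. **Oscillator groups.** Let $V$ be a real (Hausdorff) locally convex space, $\omega:V\times V\to\mathbb R$ a continuous non-degenerate skew-symmetric bilinear form, and $\gamma$ a one-parameter group of linear automorphisms of $V$ that preserve $\omega$, such that $\mathbb R\times V\to V$, $(t,x)\mapsto\gamma(t)x$, is smooth and every curve $t\mapsto \gamma(t)x$ has an antiderivative in $V$. Let $Dx=\frac{d}{dt}\big|_{0}\gamma(t)x$. The oscillator group $G=G(V,\omega,\gamma)$ is the Lie group $\mathbb R\times V\times\mathbb R$ with $$(t,x,s)(t',x',s')=\big(t+t'+\tfrac12\omega(x,\gamma(s)x'),\;x+\gamma(s)x',\;s+s'\big),$$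 with Lie algebra $\mathfrak g=\mathbb R\times V\times \mathbb R$ (product topology) and exponential map $\exp:\mathfrak g\to G$. Assume that $G$ is included in $G_A=G(V_A,\omega_A,U)$: there is an injective continuous linear map $V\hookrightarrow V_A$ with dense range that intertwines $\gamma(t)$ with $U(t)|_{V_A}$ and pulls $\omega_A$ back to $\omega$. Write $\|x\|$ for the norm in $H$ of the image of $x\in V$. **Representations.** Let $\pi:G\to \mathrm U(\mathcal H)$ be a unitary representation on a complex Hilbert space $\mathcal H\ne0$ that is smooth, i.e. the space $\mathcal H^\infty$ of all $v$ for which $g\mapsto\pi(g)v$ is smooth is dense in $\mathcal H$. For $a\in\mathfrak g$ let $\mathrm d\pi(a)v=\frac{d}{dt}\big|_{0}\pi(\exp(ta))v$ for $v\in\mathcal H^\infty$, and let $$s_\pi(a)=\sup \operatorname{Spec}\big(i\,\mathrm d\pi(a)\big)\in\mathbb R\cup\{\infty\},$$ where the spectrum is that of the closure of the essentially self-adjoint operator $i\,\mathrm d\pi(a)$. Let $B(I_\pi)=\{a\in\mathfrak g: s_\pi(a)<\infty\}$ and let $B(I_\pi)^0$ be its interior in $\mathfrak g$. The representation $\pi$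 is called semibounded if $s_\pi$ is bounded on some non-empty open subset of $\mathfrak g$. **Proposition.** Assume that $D(V)$ is dense in $V$. Then: 1. $s_\pi(t,x,s)=s_\pi\Big(t-\dfrac{\|x\|^2}{2s},\,0,\,s\Big)$ for all $(t,x,s)\in\mathfrak g$ with $s\neq 0$. 2. The restriction of $s_\pi$ to $B(I_\pi)^0$ is continuous when $V$ is equipped with the topology of the norm $\|\cdot\|$. 3. $\pi$ is semibounded if and only if $B(I_\pi)$ has an interior point. -/

import Mathlib

universe u v

noncomputable section

/-! ### Calculus in locally convex spaces -/

section Calculus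

variable {F : Type v} [AddCommGroup F] [Module ℝ F] [TopologicalSpace F]

/-- The curve `c` in the topological vector space `F` has derivative `c'` at `t`: the difference
quotients of `c` at `t` converge to `c'`. -/
def HasCurveDerivAt (c : ℝ → F) (c' : F) (t : ℝ) : Prop :=
  Filter.Tendsto (fun h : ℝ => h⁻¹ • (c (t + h) - c t)) (nhdsWithin 0 {0}ᶜ) (nhds c')

open Classical in
/-- The `F`-valued integral of a curve that has an antiderivative `B`, namely `B b - B a`
(and `0` if there is no antiderivative). -/
def vectorIntegral (c : ℝ → F) (a b : ℝ) : F :=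
  if h : ∃ B : ℝ → F, ∀ t, HasCurveDerivAt B (c t) t then h.choose b - h.choose a else 0

/-- `f : E → F` is of class `C^n` in the sense of Michal and Bastiani: `f` is continuous and, if
`n ≥ 1`, all directional derivatives exist and `(x, h) ↦ df(x)(h)` is of class `C^(n-1)` on
`E × E`. -/
def BastianiContDiff : ℕ → ∀ {E : Type u} [AddCommGroup E] [Module ℝ E] [TopologicalSpace E],
    (E → F) → Prop
  | 0, _, _, _, _, f => Continuous f
  | n + 1, E, _, _, _, f => Continuous f ∧ ∃ df : E × E → F,
      (∀ x h : E, HasCurveDerivAt (fun t : ℝ => f (x + t • h)) (df (x, h)) 0) ∧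
        BastianiContDiff n df

/-- Smooth maps between locally convex spaces. -/
def BastianiSmooth {E : Type u} [AddCommGroup E] [Module ℝ E] [TopologicalSpace E]
    (f : E → F) : Prop :=
  ∀ n : ℕ, BastianiContDiff n f

theorem HasCurveDerivAt.add [ContinuousAdd F] {c₁ c₂ : ℝ → F} {a₁ a₂ : F} {t : ℝ}
    (h₁ : HasCurveDerivAt c₁ a₁ t) (h₂ : HasCurveDerivAt c₂ a₂ t) :
    HasCurveDerivAt (fun s => c₁ s + c₂ s) (a₁ + a₂) t := by
  refine (Filter.Tendsto.add h₁ h₂).congr fun h => ?_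
  rw [← smul_add, add_sub_add_comm]

theorem HasCurveDerivAt.clm (L : F →L[ℝ] F) {c : ℝ → F} {a : F} {t : ℝ}
    (h : HasCurveDerivAt c a t) : HasCurveDerivAt (fun s => L (c s)) (L a) t := by
  refine ((L.continuous.tendsto a).comp h).congr fun h => ?_
  simp

theorem hasCurveDerivAt_const (a : F) (t : ℝ) : HasCurveDerivAt (fun _ => a) 0 t := by
  simpa [HasCurveDerivAt] using tendsto_const_nhds

theorem bastianiContDiff_zero (n : ℕ) : ∀ {E : Type u} [AddCommGroup E] [Module ℝ E]
    [TopologicalSpace E], BastianiContDiff n (fun _ : E => (0 : F)) := by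
  induction n with
  | zero => intro E _ _ _; exact continuous_const
  | succ n ih =>
    intro E _ _ _
    exact ⟨continuous_const, fun _ => 0, fun _ _ => hasCurveDerivAt_const 0 0, ih⟩

theorem BastianiContDiff.add [ContinuousAdd F] (n : ℕ) : ∀ {E : Type u} [AddCommGroup E]
    [Module ℝ E] [TopologicalSpace E] {f g : E → F}, BastianiContDiff n f →
    BastianiContDiff n g → BastianiContDiff n (fun x => f x + g x) := by
  induction n with
  | zero => intro E _ _ _ f g hf hg; exact Continuous.add hf hg
  | succ n ih =>
    rintro E _ _ _ f g ⟨hf, df, hdf, hf'⟩ ⟨hg, dg, hdg, hg'⟩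
    exact ⟨hf.add hg, _, fun x h => (hdf x h).add (hdg x h), ih hf' hg'⟩

theorem BastianiContDiff.clm (L : F →L[ℝ] F) (n : ℕ) : ∀ {E : Type u} [AddCommGroup E]
    [Module ℝ E] [TopologicalSpace E] {f : E → F}, BastianiContDiff n f →
    BastianiContDiff n (fun x => L (f x)) := by
  induction n with
  | zero => intro E _ _ _ f hf; exact L.continuous.comp hf
  | succ n ih =>
    rintro E _ _ _ f ⟨hf, df, hdf, hf'⟩
    exact ⟨L.continuous.comp hf, _, fun x h => (hdf x h).clm L, ih hf'⟩

end Calculus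

/-! ### Unbounded operators on a Hilbert space -/

section Operators

variable {H : Type u} [NormedAddCommGroup H] [InnerProductSpace ℂ H]

/-- The operator `x ↦ d/dt|₀ T(t) x`, on the space of all `x` for which this derivative exists. -/
def derivAtZero (T : ℝ → H →L[ℂ] H) : H →ₗ.[ℂ] H where
  domain :=
    { carrier := {x | DifferentiableAt ℝ (fun t => T t x) 0}
      zero_mem' := by simp
      add_mem' := fun {x y} hx hy => by
        have h := DifferentiableAt.fun_add (Set.mem_ofPred_eq ▸ hx) (Set.mem_ofPred_eq ▸ hy)
        simpa using h
      smul_mem' := fun c x hx => by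
        have h := DifferentiableAt.fun_const_smul (Set.mem_ofPred_eq ▸ hx) c
        simpa using h }
  toFun :=
    { toFun := fun x => deriv (fun t => T t (x : H)) 0
      map_add' := fun x y => by
        have h := deriv_fun_add x.2 y.2
        simpa using h
      map_smul' := fun c x => by
        have h := deriv_fun_const_smul c x.2
        simpa using h }

/-- `z` lies in the resolvent set of `T`: the map `T - z : dom T → H` is bijective with bounded
inverse `R`. -/
def InResolventSet (T : H →ₗ.[ℂ] H) (z : ℂ) : Prop :=
  ∃ R : H →L[ℂ] H, (∀ x : T.domain, R (T x - z • (x : H)) = x) ∧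
    ∀ y : H, ∃ hy : R y ∈ T.domain, T ⟨R y, hy⟩ - z • R y = y

/-- The spectrum of an unbounded operator. -/
def operatorSpectrum (T : H →ₗ.[ℂ] H) : Set ℂ := {z | ¬ InResolventSet T z}

end Operators

/-! ### Standard oscillator data -/

/-- A strongly continuous unitary one-parameter group `U(t) = e^{itA}` on `H` whose self-adjoint
generator `A` satisfies `A ≥ 0` and `ker A = 0`. -/
structure StandardOscillatorData (H : Type u) [NormedAddCommGroup H] [InnerProductSpace ℂ H]
    [CompleteSpace H] where
  U : ℝ → unitary (H →L[ℂ] H)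
  map_add : ∀ s t, U (s + t) = U s * U t
  continuous : ∀ x : H, Continuous fun t => (U t : H →L[ℂ] H) x
  nonneg : ∀ x : (-Complex.I • derivAtZero fun t => (U t : H →L[ℂ] H)).domain,
    0 ≤ (inner ℂ (x : H) ((-Complex.I • derivAtZero fun t => (U t : H →L[ℂ] H)) x)).re
  ker_eq_zero : ∀ x : (-Complex.I • derivAtZero fun t => (U t : H →L[ℂ] H)).domain,
    (-Complex.I • derivAtZero fun t => (U t : H →L[ℂ] H)) x = 0 → (x : H) = 0

namespace StandardOscillatorData

variable {H : Type u} [NormedAddCommGroup H] [InnerProductSpace ℂ H] [CompleteSpace H]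
  (S : StandardOscillatorData H)

/-- The operator `A = -i d/dt|₀ U(t)`. -/
def A : H →ₗ.[ℂ] H := -Complex.I • derivAtZero fun t => (S.U t : H →L[ℂ] H)

/-- The vectors `x` with smooth orbit map `t ↦ U(t) x`. -/
def smoothSubmodule : Submodule ℝ H where
  carrier := {x | ContDiff ℝ (⊤ : ℕ∞) fun t => (S.U t : H →L[ℂ] H) x}
  zero_mem' := by simpa using contDiff_const
  add_mem' := fun {x y} hx hy => by
    have h := ContDiff.add (Set.mem_ofPred_eq ▸ hx) (Set.mem_ofPred_eq ▸ hy)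
    simpa using h
  smul_mem' := fun c x hx => by
    have h := ContDiff.const_smul c (Set.mem_ofPred_eq ▸ hx)
    simpa using h

/-- The space `V_A = C^∞(A)` of smooth vectors; it carries the `C^∞`-topology below, not the
topology of `H`. -/
def SmoothSpace : Type u := S.smoothSubmodule

instance : AddCommGroup S.SmoothSpace := inferInstanceAs (AddCommGroup S.smoothSubmodule)
instance : Module ℝ S.SmoothSpace := inferInstanceAs (Module ℝ S.smoothSubmodule)

/-- The inclusion of `V_A` in `H`. -/
def val : S.SmoothSpace →ₗ[ℝ] H := S.smoothSubmodule.subtype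

/-- The `C^∞`-topology, given by the seminorms `‖A^k x‖ = ‖(d/dt)^k|₀ U(t) x‖`. -/
instance : TopologicalSpace S.SmoothSpace :=
  TopologicalSpace.induced
    (fun x (k : ℕ) => iteratedDeriv k (fun t => (S.U t : H →L[ℂ] H) (S.val x)) 0)
    Pi.topologicalSpace

theorem val_mem_domain (x : S.SmoothSpace) : S.val x ∈ S.A.domain :=
  ContDiff.differentiable (n := (⊤ : ℕ∞)) x.2 (by simp) 0

/-- The symplectic form `ω_A(x, y) = Im ⟨A x, y⟩` on `V_A`, where `⟨·, ·⟩` is linear in its first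
argument (Mathlib's `inner` is linear in the second one). -/
def ω (x y : S.SmoothSpace) : ℝ :=
  (inner ℂ (S.val y) (S.A ⟨S.val x, S.val_mem_domain x⟩)).im

end StandardOscillatorData

/-! ### Oscillator groups -/

/-- A symplectic form `ω` on a locally convex space `V` together with a one-parameter group `γ` of
symplectic linear maps that acts smoothly and whose orbit maps have `V`-valued integrals. -/
structure OscillatorData (V : Type u) [AddCommGroup V] [Module ℝ V] [TopologicalSpace V] where
  ω : V →ₗ[ℝ] V →ₗ[ℝ] ℝ
  ω_self : ∀ x, ω x x = 0
  ω_nondegenerate : ∀ x, (∀ y, ω x y = 0) → x = 0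
  ω_continuous : Continuous fun p : V × V => ω p.1 p.2
  γ : ℝ → V →ₗ[ℝ] V
  γ_zero : γ 0 = LinearMap.id
  γ_add : ∀ s t, γ (s + t) = γ s ∘ₗ γ t
  ω_γ : ∀ t x y, ω (γ t x) (γ t y) = ω x y
  γ_smooth : BastianiSmooth fun p : ℝ × V => γ p.1 p.2
  γ_integral : ∀ x, ∃ B : ℝ → V, ∀ t, HasCurveDerivAt B (γ t x) t

/-- The oscillator group `G(V, ω, γ) = Heis(V, ω) ⋊_γ ℝ = ℝ ×_ω V ⋊_γ ℝ`. As a manifold it is the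
locally convex space `ℝ × V × ℝ`, which is also (the space underlying) its Lie algebra. -/
@[ext]
structure OscillatorGroup {V : Type u} [AddCommGroup V] [Module ℝ V] [TopologicalSpace V]
    (d : OscillatorData V) where
  z : ℝ
  x : V
  s : ℝ

namespace OscillatorGroup

variable {V : Type u} [AddCommGroup V] [Module ℝ V] [TopologicalSpace V] {d : OscillatorData V}

instance : Mul (OscillatorGroup d) :=
  ⟨fun g h => ⟨g.z + h.z + (1 / 2) * d.ω g.x (d.γ g.s h.x), g.x + d.γ g.s h.x, g.s + h.s⟩⟩

instance : One (OscillatorGroup d) := ⟨⟨0, 0, 0⟩⟩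

instance : Inv (OscillatorGroup d) := ⟨fun g => ⟨-g.z, -d.γ (-g.s) g.x, -g.s⟩⟩

theorem mul_def (g h : OscillatorGroup d) : g * h =
    ⟨g.z + h.z + (1 / 2) * d.ω g.x (d.γ g.s h.x), g.x + d.γ g.s h.x, g.s + h.s⟩ := rfl

theorem one_def : (1 : OscillatorGroup d) = ⟨0, 0, 0⟩ := rfl

theorem inv_def (g : OscillatorGroup d) : g⁻¹ = ⟨-g.z, -d.γ (-g.s) g.x, -g.s⟩ := rfl

instance : Group (OscillatorGroup d) :=
  Group.ofLeftAxioms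
    (fun a b c => by
      simp only [mul_def, d.γ_add, map_add, LinearMap.add_apply, LinearMap.comp_apply, d.ω_γ]
      ext
      · ring
      · exact add_assoc _ _ _
      · exact add_assoc _ _ _)
    (fun a => by simp [mul_def, one_def, d.γ_zero])
    (fun a => by simp [mul_def, one_def, inv_def, d.ω_self])

/-- The exponential map
`exp(z,x,s) = (z + ½ ∫₀¹ ∫₀¹ ω(γ(s t t')x, γ(s t)x) t dt' dt, ∫₀¹ γ(s t)x dt, s)` of `G(V, ω, γ)`. -/
def exp (d : OscillatorData V) (a : ℝ × V × ℝ) : OscillatorGroup d where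
  z := a.1 + (1 / 2) * ∫ t in (0 : ℝ)..1, ∫ t' in (0 : ℝ)..1,
    d.ω (d.γ (a.2.2 * t * t') a.2.1) (d.γ (a.2.2 * t) a.2.1) * t
  x := vectorIntegral (fun t => d.γ (a.2.2 * t) a.2.1) 0 1
  s := a.2.2

end OscillatorGroup

/-- The range `D(V)` of the generator `D x = d/dt|₀ γ(t) x`. -/
def OscillatorData.rangeD {V : Type u} [AddCommGroup V] [Module ℝ V] [TopologicalSpace V]
    (d : OscillatorData V) : Set V :=
  {y | ∃ x : V, HasCurveDerivAt (fun t => d.γ t x) y 0}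

/-- A dense inclusion `V ↪ V_A` for which `(t, x, s) ↦ (t, x, s)` is an inclusion of the oscillator
group `G(V, ω, γ)` in the standard oscillator group `G_A` and of their Lie algebras. -/
structure StandardEmbedding {V : Type u} [AddCommGroup V] [Module ℝ V] [TopologicalSpace V]
    (d : OscillatorData V) {H : Type v} [NormedAddCommGroup H] [InnerProductSpace ℂ H]
    [CompleteSpace H] (S : StandardOscillatorData H) where
  ι : V →ₗ[ℝ] S.SmoothSpace
  injective : Function.Injective ι
  continuous : Continuous ι
  denseRange : DenseRange ι
  map_γ : ∀ t x, S.val (ι (d.γ t x)) = (S.U t : H →L[ℂ] H) (S.val (ι x))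
  map_ω : ∀ x y, S.ω (ι x) (ι y) = d.ω x y

/-- The topology of `ℝ × V × ℝ` for which `V` carries the topology of the norm of `H`. -/
@[reducible] def StandardEmbedding.normTopology {V : Type u} [AddCommGroup V] [Module ℝ V] [TopologicalSpace V]
    {d : OscillatorData V} {H : Type v} [NormedAddCommGroup H] [InnerProductSpace ℂ H]
    [CompleteSpace H] {S : StandardOscillatorData H} (e : StandardEmbedding d S) :
    TopologicalSpace (ℝ × V × ℝ) :=
  TopologicalSpace.induced (fun a => ((a.1, S.val (e.ι a.2.1), a.2.2) : ℝ × H × ℝ)) inferInstance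

/-! ### Unitary representations of oscillator groups -/

section Representations

variable {V : Type u} [AddCommGroup V] [Module ℝ V] [TopologicalSpace V] {d : OscillatorData V}
  {K : Type v} [NormedAddCommGroup K] [InnerProductSpace ℂ K] [CompleteSpace K]
  (π : OscillatorGroup d →* unitary (K →L[ℂ] K))

/-- The space of smooth vectors: those `v` for which `g ↦ π(g)v` is smooth. -/
def smoothVectors : Submodule ℂ K where
  carrier := {v | BastianiSmooth fun p : ℝ × V × ℝ =>
    (π ⟨p.1, p.2.1, p.2.2⟩ : K →L[ℂ] K) v}
  zero_mem' := fun n => by simpa using bastianiContDiff_zero n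
  add_mem' := fun {v w} hv hw n => by simpa using BastianiContDiff.add n (hv n) (hw n)
  smul_mem' := fun c v hv n => by
    simpa using BastianiContDiff.clm
      ((c • ContinuousLinearMap.id ℂ K).restrictScalars ℝ) n (hv n)

/-- A unitary representation is smooth if the smooth vectors are dense. -/
def IsSmoothRep : Prop := Dense (smoothVectors π : Set K)

/-- The derived representation `dπ(a)v = d/dt|₀ π(exp(ta))v` on smooth vectors. (The derivative
exists for every smooth vector, so that the domain of this operator is `smoothVectors π`.) -/
def derivedRep (a : ℝ × V × ℝ) : K →ₗ.[ℂ] K :=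
  (derivAtZero fun t => (π (OscillatorGroup.exp d (t • a)) : K →L[ℂ] K)).domRestrict
    (smoothVectors π)

/-- The support function `s_π(a) = sup Spec(i dπ(a))`, where the spectrum of the essentially
self-adjoint operator `i dπ(a)` is that of its closure. -/
def supportFunction (a : ℝ × V × ℝ) : EReal :=
  sSup {r : EReal | ∃ t : ℝ, r = t ∧
    (t : ℂ) ∈ operatorSpectrum (Complex.I • derivedRep π a).closure}

/-- The set `B(I_π)` of all `a` with `s_π(a) < ∞`. -/
def boundedCone : Set (ℝ × V × ℝ) := {a | supportFunction π a < ⊤}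

/-- `π` is semibounded: its support function is bounded on a non-empty open set. -/
def IsSemibounded : Prop :=
  ∃ W : Set (ℝ × V × ℝ), IsOpen W ∧ W.Nonempty ∧ ∃ C : ℝ, ∀ a ∈ W,
    ((-C : ℝ) : EReal) ≤ supportFunction π a ∧ supportFunction π a ≤ (C : EReal)

end Representations

end

-- For a smooth vector `v`, the map φ_v(a) = ⟨i dπ(a)v, v⟩ is a continuous real linear functional on
-- the Lie algebra, and s_π(a) ≤ M holds exactly when φ_v(a) ≤ M‖v‖² for all `v`
-- (`supportFunction_le_iff`). Thus s_π is a supremum of continuous linear functionals, hence convex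
-- and lower semicontinuous. Behind this lies the fact that the spectrum of the closure has the same
-- upper bounds as the numerical range on the smooth vectors (`forall_mem_operatorSpectrum_le_iff`),
-- which holds because this domain is dense and invariant under the one-parameter group.
--
-- Since π permutes the smooth vectors isometrically, s_π is invariant under the adjoint action.
-- With w = Dy one has Ad(0,y,0)(t,x,s) = (t + ω(y,x) + (s/2)ω(w,y), x - sw, s). Because D = iA,
-- ω(y,x) = -Re⟨w,x⟩ and ω(w,y) = ‖w‖²: the result depends on `w` alone, and continuously. Density
-- of D(V) and lower semicontinuity then give an inequality for every `w` in V
-- (`supportFunction_conj_le`). For s ≠ 0, the choices w = x/s and w = -x/s complete the square in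
-- both directions, which is the first claim.
--
-- The same formula reduces continuity to the plane x = 0: s_π factors through (t - ‖x‖²/(2s), s),
-- and a finite convex function on an open subset of a plane is continuous. An interior point of
-- B(I_π) with s = 0 is degenerate: there the orbit contains whole lines in the central direction,
-- so the centre acts trivially, and then all φ_v vanish on V (`supportFunction_eq_zero_mid`).
-- Continuity at an interior point yields local boundedness, hence semiboundedness.

universe w₁ w₂

noncomputable section

/-! ### Calculus in topological vector spaces -/

section BastianiCalculus

open Filter Topology

variable {E : Type u} [AddCommGroup E] [Module ℝ E] [TopologicalSpace E]

theorem hasCurveDerivAt_iff_hasDerivAt {F : Type v} [NormedAddCommGroup F] [NormedSpace ℝ F]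
    {c : ℝ → F} {c' : F} {t : ℝ} : HasCurveDerivAt c c' t ↔ HasDerivAt c c' t :=
  hasDerivAt_iff_tendsto_slope_zero.symm

theorem HasCurveDerivAt.tendsto [ContinuousAdd E] [ContinuousSMul ℝ E] {c : ℝ → E} {c' : E}
    {t : ℝ} (h : HasCurveDerivAt c c' t) :
    Tendsto (fun r : ℝ => c (t + r)) (𝓝[≠] 0) (𝓝 (c t)) := by
  have h0 : Tendsto (fun r : ℝ => r) (𝓝[≠] 0) (𝓝 0) := nhdsWithin_le_nhds
  have h1 := (h0.smul h).const_add (c t)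
  rw [zero_smul, add_zero] at h1
  refine h1.congr' ?_
  filter_upwards [self_mem_nhdsWithin] with r hr
  rw [smul_inv_smul₀ hr]
  abel

theorem HasCurveDerivAt.map {F : Type v} [AddCommGroup F] [Module ℝ F] [TopologicalSpace F]
    (L : E →L[ℝ] F) {c : ℝ → E} {c' : E} {t : ℝ} (h : HasCurveDerivAt c c' t) :
    HasCurveDerivAt (fun r => L (c r)) (L c') t := by
  refine ((L.continuous.tendsto c').comp h).congr fun h => ?_
  simp

theorem HasCurveDerivAt.const_add {c : ℝ → E} {c' : E} {t : ℝ}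
    (h : HasCurveDerivAt c c' t) (a : E) : HasCurveDerivAt (fun r => a + c r) c' t :=
  Tendsto.congr (fun r => by rw [add_sub_add_left_eq_sub]) h

theorem HasCurveDerivAt.prodMk {F : Type v} [AddCommGroup F] [Module ℝ F] [TopologicalSpace F]
    {c : ℝ → E} {c' : E} {b : ℝ → F} {b' : F} {t : ℝ} (hc : HasCurveDerivAt c c' t)
    (hb : HasCurveDerivAt b b' t) : HasCurveDerivAt (fun r => (c r, b r)) (c', b') t :=
  Tendsto.prodMk_nhds hc hb

/-- Difference quotients of a `C^1` map with values in a normed space converge locally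
uniformly. -/
theorem tendsto_slope_of_hasCurveDerivAt [ContinuousAdd E] [ContinuousSMul ℝ E]
    {F : Type v} [NormedAddCommGroup F] [NormedSpace ℝ F] {f : E → F} {df : E × E → F}
    (hdf : ∀ x h : E, HasCurveDerivAt (fun t : ℝ => f (x + t • h)) (df (x, h)) 0)
    (hc : Continuous df) {p q : ℝ → E} {x w : E} (hp : Tendsto p (𝓝[≠] 0) (𝓝 x))
    (hq : Tendsto q (𝓝[≠] 0) (𝓝 w)) :
    Tendsto (fun h : ℝ => h⁻¹ • (f (p h + h • q h) - f (p h))) (𝓝[≠] 0) (𝓝 (df (x, w))) := by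
  rw [Metric.tendsto_nhds]
  intro ε hε
  have hmap : Continuous fun z : ℝ × E × E => df (z.2.1 + z.1 • z.2.2, z.2.2) := by fun_prop
  -- Joint continuity of `df` makes the estimate uniform over nearby base points and directions, so
  -- both may vary with `h`.
  have hN : {z : ℝ × E × E | ‖df (z.2.1 + z.1 • z.2.2, z.2.2) - df (x, w)‖ < ε / 2} ∈
      𝓝 ((0 : ℝ), (x, w)) := by
    refine (isOpen_lt (hmap.sub continuous_const).norm continuous_const).mem_nhds ?_
    simpa using hε
  rw [nhds_prod_eq, Filter.mem_prod_iff] at hN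
  obtain ⟨A, hA, B, hB, hAB⟩ := hN
  obtain ⟨δ, hδ, hδA⟩ := Metric.mem_nhds_iff.1 hA
  have hball : Metric.ball (0 : ℝ) δ ∈ 𝓝[≠] (0 : ℝ) :=
    nhdsWithin_le_nhds (Metric.ball_mem_nhds 0 hδ)
  filter_upwards [(hp.prodMk_nhds hq) hB, hball, self_mem_nhdsWithin] with h hpq hh hh0
  -- The linear term is subtracted first, so that the mean value inequality bounds the error by ε/2
  -- times |h|.
  have hder : ∀ r ∈ Metric.ball (0 : ℝ) δ,
      HasDerivWithinAt (fun r : ℝ => f (p h + r • q h) - r • df (x, w))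
        (df (p h + r • q h, q h) - df (x, w)) (Metric.ball 0 δ) r := by
    intro r _
    have h1 := hdf (p h + r • q h) (q h)
    rw [HasCurveDerivAt] at h1
    have h2 : HasDerivAt (fun r : ℝ => f (p h + r • q h)) (df (p h + r • q h, q h)) r := by
      rw [hasDerivAt_iff_tendsto_slope_zero]
      refine h1.congr fun k => ?_
      simp only [zero_add, zero_smul, add_zero, add_smul, add_assoc]
    have h3 := h2.sub ((hasDerivAt_id r).smul_const (df (x, w)))
    rw [one_smul] at h3
    exact h3.hasDerivWithinAt
  have hmv := (convex_ball (0 : ℝ) δ).norm_image_sub_le_of_norm_hasDerivWithin_le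
    (C := ε / 2) hder (fun r hr => le_of_lt (hAB (Set.mk_mem_prod (hδA hr) hpq)))
    (Metric.mem_ball_self hδ) hh
  simp only [zero_smul, add_zero, sub_zero] at hmv
  have hh0' : h ≠ 0 := hh0
  have heq : h⁻¹ • (f (p h + h • q h) - f (p h)) - df (x, w) =
      h⁻¹ • (f (p h + h • q h) - h • df (x, w) - f (p h)) := by
    rw [sub_right_comm, smul_sub h⁻¹ (_ - _), inv_smul_smul₀ hh0']
  rw [dist_eq_norm, heq, norm_smul, norm_inv]
  have hpos : 0 < ‖h‖ := norm_pos_iff.2 hh0'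
  calc ‖h‖⁻¹ * _ ≤ ‖h‖⁻¹ * (ε / 2 * ‖h‖) := by gcongr
    _ = ε / 2 := by field_simp
    _ < ε := by linarith

/-- The chain rule along a curve. -/
theorem HasCurveDerivAt.comp_of_continuous [ContinuousAdd E] [ContinuousSMul ℝ E]
    {F : Type v} [NormedAddCommGroup F] [NormedSpace ℝ F] {f : E → F} {df : E × E → F}
    (hdf : ∀ x h : E, HasCurveDerivAt (fun t : ℝ => f (x + t • h)) (df (x, h)) 0)
    (hc : Continuous df) {c : ℝ → E} {c' : E} {t : ℝ} (h : HasCurveDerivAt c c' t) :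
    HasCurveDerivAt (fun r => f (c r)) (df (c t, c')) t := by
  refine (tendsto_slope_of_hasCurveDerivAt hdf hc (tendsto_const_nhds (x := c t)) h).congr' ?_
  filter_upwards [self_mem_nhdsWithin] with r hr
  rw [smul_inv_smul₀ hr, add_sub_cancel]

/-- The differential of a `C^1` map is additive in the direction. -/
theorem differential_add [ContinuousAdd E] [ContinuousSMul ℝ E]
    {F : Type v} [NormedAddCommGroup F] [NormedSpace ℝ F] {f : E → F} {df : E × E → F}
    (hdf : ∀ x h : E, HasCurveDerivAt (fun t : ℝ => f (x + t • h)) (df (x, h)) 0)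
    (hc : Continuous df) (x v w : E) : df (x, v + w) = df (x, v) + df (x, w) := by
  have h0 : Tendsto (fun r : ℝ => r) (𝓝[≠] 0) (𝓝 0) := nhdsWithin_le_nhds
  have hp : Tendsto (fun r : ℝ => x + r • v) (𝓝[≠] 0) (𝓝 x) := by
    have := (h0.smul_const v).const_add x
    rwa [zero_smul, add_zero] at this
  have h1 := tendsto_slope_of_hasCurveDerivAt hdf hc hp (tendsto_const_nhds (x := w))
  have h2 := tendsto_slope_of_hasCurveDerivAt hdf hc (tendsto_const_nhds (x := x))
    (tendsto_const_nhds (x := v))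
  have h3 := tendsto_slope_of_hasCurveDerivAt hdf hc (tendsto_const_nhds (x := x))
    (tendsto_const_nhds (x := v + w))
  refine tendsto_nhds_unique h3 ((h2.add h1).congr fun r => ?_)
  rw [← smul_add, smul_add r v w, ← add_assoc, add_comm, sub_add_sub_cancel]

/-- The differential of a `C^1` map is homogeneous in the direction. -/
theorem differential_smul [ContinuousAdd E] [ContinuousSMul ℝ E]
    {F : Type v} [NormedAddCommGroup F] [NormedSpace ℝ F] {f : E → F} {df : E × E → F}
    (hdf : ∀ x h : E, HasCurveDerivAt (fun t : ℝ => f (x + t • h)) (df (x, h)) 0)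
    (x v : E) (a : ℝ) : df (x, a • v) = a • df (x, v) := by
  have h1 : HasDerivAt (fun t : ℝ => f (x + t • v)) (df (x, v)) (a * 0) := by
    rw [mul_zero]
    exact hasCurveDerivAt_iff_hasDerivAt.1 (hdf x v)
  have h2 : HasDerivAt (fun t : ℝ => f (x + t • a • v)) (df (x, a • v)) 0 :=
    hasCurveDerivAt_iff_hasDerivAt.1 (hdf x (a • v))
  have h3 := h1.scomp (0 : ℝ) ((hasDerivAt_id (0 : ℝ)).const_mul a)
  rw [mul_one] at h3
  refine h2.unique (h3.congr_of_eventuallyEq (Eventually.of_forall fun t => ?_))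
  simp [mul_comm a t, mul_smul]

theorem BastianiContDiff.continuous {F : Type v} [AddCommGroup F] [Module ℝ F]
    [TopologicalSpace F] {n : ℕ} {f : E → F} (hf : BastianiContDiff n f) : Continuous f := by
  cases n with
  | zero => exact hf
  | succ n => exact hf.1

theorem BastianiContDiff.of_succ {F : Type v} [AddCommGroup F] [Module ℝ F]
    [TopologicalSpace F] (n : ℕ) : ∀ {E : Type u} [AddCommGroup E] [Module ℝ E]
    [TopologicalSpace E] {f : E → F}, BastianiContDiff (n + 1) f → BastianiContDiff n f := by
  induction n with
  | zero => intro E _ _ _ f hf; exact hf.1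
  | succ n ih =>
    rintro E _ _ _ f ⟨hf, df, hdf, hdf'⟩
    exact ⟨hf, df, hdf, ih hdf'⟩

theorem BastianiContDiff.comp_affine {F : Type v} [AddCommGroup F] [Module ℝ F]
    [TopologicalSpace F] (n : ℕ) : ∀ {E E' : Type u} [AddCommGroup E] [Module ℝ E]
    [TopologicalSpace E] [ContinuousAdd E] [AddCommGroup E'] [Module ℝ E'] [TopologicalSpace E']
    {f : E → F} (_ : BastianiContDiff n f) (L : E' →L[ℝ] E) (c : E),
    BastianiContDiff n fun x => f (L x + c) := by
  induction n with
  | zero =>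
    intro E E' _ _ _ _ _ _ _ f hf L c
    exact Continuous.comp hf (L.continuous.add continuous_const)
  | succ n ih =>
    rintro E E' _ _ _ _ _ _ _ f ⟨hf, df, hdf, hdf'⟩ L c
    refine ⟨hf.comp (L.continuous.add continuous_const), fun z => df (L z.1 + c, L z.2),
      fun x h => ?_, ?_⟩
    · have := hdf (L x + c) (L h)
      simpa [add_right_comm] using this
    · refine (congrArg (BastianiContDiff n) (funext fun z => ?_)).mp (ih hdf' (L.prodMap L) (c, 0))
      exact congrArg df (Prod.ext rfl (add_zero _))

theorem BastianiContDiff.comp_clm {F : Type v} [AddCommGroup F] [Module ℝ F]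
    [TopologicalSpace F] {n : ℕ} {E E' : Type u} [AddCommGroup E] [Module ℝ E]
    [TopologicalSpace E] [ContinuousAdd E] [AddCommGroup E'] [Module ℝ E'] [TopologicalSpace E']
    {f : E → F} (hf : BastianiContDiff n f) (L : E' →L[ℝ] E) :
    BastianiContDiff n fun x => f (L x) := by
  simpa using hf.comp_affine n L 0

theorem bastianiContDiff_const {F : Type v} [AddCommGroup F] [Module ℝ F]
    [TopologicalSpace F] (n : ℕ) (a : F) : BastianiContDiff n (fun _ : E => a) := by
  cases n with
  | zero => exact continuous_const
  | succ n => exact ⟨continuous_const, fun _ => 0, fun _ _ => hasCurveDerivAt_const a 0,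
      bastianiContDiff_zero n⟩

theorem bastianiContDiff_clm {F : Type v} [AddCommGroup F] [Module ℝ F]
    [TopologicalSpace F] (n : ℕ) : ∀ {E : Type u} [AddCommGroup E] [Module ℝ E]
    [TopologicalSpace E] (L : E →L[ℝ] F), BastianiContDiff n fun x => L x := by
  induction n with
  | zero => intro E _ _ _ L; exact L.continuous
  | succ n ih =>
    intro E _ _ _ L
    refine ⟨L.continuous, fun z => L z.2, fun x h => ?_, ih (L.comp (.snd ℝ E E))⟩
    refine (tendsto_const_nhds (x := L h)).congr' ?_
    filter_upwards [self_mem_nhdsWithin] with r hr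
    have hr' : r ≠ 0 := hr
    simp [inv_smul_smul₀ hr']

theorem BastianiContDiff.prodMk {F : Type v} [AddCommGroup F] [Module ℝ F]
    [TopologicalSpace F] {F' : Type w₁} [AddCommGroup F'] [Module ℝ F']
    [TopologicalSpace F'] (n : ℕ) : ∀ {E : Type u} [AddCommGroup E] [Module ℝ E]
    [TopologicalSpace E] {f : E → F} {g : E → F'}, BastianiContDiff n f → BastianiContDiff n g →
    BastianiContDiff n fun x => (f x, g x) := by
  induction n with
  | zero => intro E _ _ _ f g hf hg; exact Continuous.prodMk hf hg
  | succ n ih =>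
    rintro E _ _ _ f g ⟨hf, df, hdf, hf'⟩ ⟨hg, dg, hdg, hg'⟩
    exact ⟨hf.prodMk hg, _, fun x h => (hdf x h).prodMk (hdg x h), ih hf' hg'⟩

/-- The product rule for continuous bilinear maps. -/
theorem HasCurveDerivAt.bilinear {F₁ F₂ F : Type*} [AddCommGroup F₁] [Module ℝ F₁]
    [TopologicalSpace F₁] [AddCommGroup F₂] [Module ℝ F₂] [TopologicalSpace F₂]
    [ContinuousAdd F₂] [ContinuousSMul ℝ F₂] [AddCommGroup F] [Module ℝ F]
    [TopologicalSpace F] [ContinuousAdd F] (B : F₁ →ₗ[ℝ] F₂ →ₗ[ℝ] F)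
    (hB : Continuous fun z : F₁ × F₂ => B z.1 z.2) {b : ℝ → F₁} {b' : F₁} {c : ℝ → F₂} {c' : F₂}
    {t : ℝ} (hb : HasCurveDerivAt b b' t) (hc : HasCurveDerivAt c c' t) :
    HasCurveDerivAt (fun r => B (b r) (c r)) (B b' (c t) + B (b t) c') t := by
  have h1 := (hB.tendsto (b', c t)).comp (hb.prodMk_nhds hc.tendsto)
  have h2 := (hB.tendsto (b t, c')).comp ((tendsto_const_nhds (x := b t)).prodMk_nhds hc)
  refine (h1.add h2).congr fun r => ?_
  simp only [Function.comp, map_smul, map_sub, LinearMap.smul_apply, LinearMap.sub_apply]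
  rw [← smul_add, sub_add_sub_cancel]

theorem BastianiContDiff.bilinear {F₁ : Type w₁} {F₂ : Type w₂} {F : Type v} [AddCommGroup F₁] [Module ℝ F₁]
    [TopologicalSpace F₁] [AddCommGroup F₂] [Module ℝ F₂] [TopologicalSpace F₂]
    [ContinuousAdd F₂] [ContinuousSMul ℝ F₂] [AddCommGroup F] [Module ℝ F]
    [TopologicalSpace F] [ContinuousAdd F] (B : F₁ →ₗ[ℝ] F₂ →ₗ[ℝ] F)
    (hB : Continuous fun z : F₁ × F₂ => B z.1 z.2) (n : ℕ) : ∀ {E : Type u} [AddCommGroup E]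
    [Module ℝ E] [TopologicalSpace E] [ContinuousAdd E] {f : E → F₁} {g : E → F₂},
    BastianiContDiff n f →
    BastianiContDiff n g → BastianiContDiff n fun x => B (f x) (g x) := by
  induction n with
  | zero => intro E _ _ _ _ f g hf hg; exact hB.comp (Continuous.prodMk hf hg)
  | succ n ih =>
    intro E _ _ _ _ f g hf hg
    have hfn := (hf.of_succ n).comp_clm (.fst ℝ E E)
    have hgn := (hg.of_succ n).comp_clm (.fst ℝ E E)
    obtain ⟨hf, df, hdf, hf'⟩ := hf
    obtain ⟨hg, dg, hdg, hg'⟩ := hg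
    refine ⟨hB.comp (hf.prodMk hg), fun z => B (df z) (g z.1) + B (f z.1) (dg z),
      fun x h => ?_, (ih hf' hgn).add n (ih hfn hg')⟩
    simpa using (hdf x h).bilinear B hB (hdg x h)

/-- The chain rule for maps of class `C^n`. -/
theorem BastianiContDiff.comp {F : Type v} [NormedAddCommGroup F] [NormedSpace ℝ F] (n : ℕ) :
    ∀ {E E' : Type u} [AddCommGroup E] [Module ℝ E] [TopologicalSpace E] [ContinuousAdd E]
    [ContinuousSMul ℝ E] [AddCommGroup E'] [Module ℝ E'] [TopologicalSpace E'] [ContinuousAdd E']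
    {f : E → F} {g : E' → E}, BastianiContDiff n f → BastianiContDiff n g →
    BastianiContDiff n fun x => f (g x) := by
  induction n with
  | zero => intro E E' _ _ _ _ _ _ _ _ _ f g hf hg; exact Continuous.comp hf hg
  | succ n ih =>
    intro E E' _ _ _ _ _ _ _ _ _ f g hf hg
    have hgn := (hg.of_succ n).comp_clm (.fst ℝ E' E')
    obtain ⟨hf, df, hdf, hf'⟩ := hf
    obtain ⟨hg, dg, hdg, hg'⟩ := hg
    refine ⟨hf.comp hg, fun z => df (g z.1, dg z), fun x h => ?_, ih hf' (hgn.prodMk n hg')⟩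
    simpa using (hdg x h).comp_of_continuous hdf hf'.continuous

theorem BastianiContDiff.exists_differential [ContinuousAdd E] [ContinuousSMul ℝ E]
    {F : Type v} [NormedAddCommGroup F] [NormedSpace ℝ F] {f : E → F}
    (hf : BastianiContDiff 1 f) (x : E) :
    ∃ L : E →L[ℝ] F, ∀ (c : ℝ → E) (c' : E) (t : ℝ), c t = x → HasCurveDerivAt c c' t →
      HasDerivAt (fun r => f (c r)) (L c') t := by
  obtain ⟨-, df, hdf, hdfc⟩ := hf
  have hc : Continuous df := hdfc
  refine ⟨⟨⟨⟨fun a => df (x, a), differential_add hdf hc x⟩,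
    fun r a => differential_smul hdf x a r⟩, hc.comp (Continuous.prodMk_right x)⟩,
    fun c c' t h0 h => ?_⟩
  subst h0
  exact hasCurveDerivAt_iff_hasDerivAt.1 (h.comp_of_continuous hdf hc)

end BastianiCalculus

/-! ### Resolvents of closed operators -/

section Resolvents

open Filter Topology

variable {K : Type v} [NormedAddCommGroup K] [InnerProductSpace ℂ K]

/-- `R` is the bounded inverse of `T - z`. -/
def IsResolventAt (T : K →ₗ.[ℂ] K) (z : ℂ) (R : K →L[ℂ] K) : Prop :=
  (∀ x : T.domain, R (T x - z • (x : K)) = x) ∧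
    ∀ y : K, ∃ hy : R y ∈ T.domain, T ⟨R y, hy⟩ - z • R y = y

theorem LinearPMap.IsClosable.closure_induction {T : K →ₗ.[ℂ] K} (hT : T.IsClosable)
    {P : K × K → Prop} (hP : _root_.IsClosed {p | P p}) (h : ∀ x : T.domain, P (x, T x))
    (x : T.closure.domain) : P (x, T.closure x) := by
  have h1 : ((x : K), T.closure x) ∈ T.graph.topologicalClosure := by
    rw [hT.graph_closure_eq_closure_graph]
    exact T.closure.mem_graph x
  have h2 : T.graph.topologicalClosure.carrier ⊆ {p | P p} := by
    refine closure_minimal ?_ hP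
    intro p hp
    obtain ⟨y, hy⟩ := (T.mem_graph_iff').1 hp
    exact hy ▸ h y
  exact h2 h1

/-- The lower bound makes `T - z` injective with bounded inverse on its range. Approximating
preimages are Cauchy by the same bound, so closedness of `T` upgrades the dense range to all of `K`.
-/
theorem exists_isResolventAt_of_bound [CompleteSpace K] {T : K →ₗ.[ℂ] K} (hT : T.IsClosed) {z : ℂ}
    {c : ℝ} (hc : 0 < c) (hb : ∀ x : T.domain, c * ‖(x : K)‖ ≤ ‖T x - z • (x : K)‖)
    (hd : Dense (Set.range fun x : T.domain => T x - z • (x : K))) :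
    ∃ R : K →L[ℂ] K, IsResolventAt T z R ∧ ‖R‖ ≤ c⁻¹ := by
  let S : T.domain →ₗ[ℂ] K := T.toFun - z • T.domain.subtype
  have hS : ∀ x, S x = T x - z • (x : K) := fun x => rfl
  have hinj : Function.Injective S := by
    rw [injective_iff_map_eq_zero]
    intro x hx
    have h1 := hb x
    rw [← hS, hx, norm_zero] at h1
    have h2 : ‖(x : K)‖ ≤ 0 := by
      by_contra h
      nlinarith
    exact Subtype.ext (norm_le_zero_iff.1 h2)
  have hsurj : Function.Surjective S := by
    intro y
    obtain ⟨s, hs, hlim⟩ := mem_closure_iff_seq_limit.1 (hd y)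
    choose x hx using hs
    have hx' : ∀ n, S (x n) = s n := hx
    have hcau : CauchySeq fun n => (x n : K) := by
      have h1 := hlim.cauchySeq
      rw [Metric.cauchySeq_iff] at h1 ⊢
      intro ε hε
      obtain ⟨N, hN⟩ := h1 (c * ε) (by positivity)
      refine ⟨N, fun m hm n hn => ?_⟩
      have h2 := hN m hm n hn
      have h3 := hb (x m - x n)
      rw [← hS, map_sub, hx', hx', ← dist_eq_norm, Submodule.coe_sub, ← dist_eq_norm] at h3
      exact lt_of_mul_lt_mul_left (h3.trans_lt h2) hc.le
    obtain ⟨x₀, hx₀⟩ := cauchySeq_tendsto_of_complete hcau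
    have hTx : Tendsto (fun n => T (x n)) atTop (𝓝 (y + z • x₀)) := by
      refine (hlim.add (hx₀.const_smul z)).congr fun n => ?_
      rw [← hx', hS, sub_add_cancel]
    have hmem : (x₀, y + z • x₀) ∈ T.graph :=
      hT.mem_of_tendsto (hx₀.prodMk_nhds hTx) (Eventually.of_forall fun n => T.mem_graph (x n))
    obtain ⟨w, hw⟩ := (T.mem_graph_iff').1 hmem
    refine ⟨w, ?_⟩
    obtain ⟨hw1, hw2⟩ := Prod.ext_iff.1 hw
    dsimp only at hw1 hw2
    rw [hS, hw1, hw2, add_sub_cancel_right]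
  let e := LinearEquiv.ofBijective S ⟨hinj, hsurj⟩
  have he : ∀ y, S (e.symm y) = y := fun y => e.apply_symm_apply y
  let R : K →L[ℂ] K := (T.domain.subtype ∘ₗ e.symm.toLinearMap).mkContinuous c⁻¹ fun y => by
    have h1 := hb (e.symm y)
    rw [← hS, he] at h1
    rw [inv_mul_eq_div, le_div_iff₀ hc, mul_comm]
    exact h1
  have hR : ∀ y, R y = e.symm y := fun y => rfl
  refine ⟨R, ⟨fun x => ?_, fun y => ?_⟩, LinearMap.mkContinuous_norm_le _ (by positivity) _⟩
  · rw [hR, ← hS]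
    exact congrArg Subtype.val (e.symm_apply_apply x)
  · refine ⟨by rw [hR]; exact (e.symm y).2, ?_⟩
    exact he y

/-- A uniform bound for the resolvents at nearby points shows that `w` is in the resolvent set. -/
theorem IsResolventAt.inResolventSet_of_norm_lt [CompleteSpace K] {T : K →ₗ.[ℂ] K} {z w : ℂ}
    {R : K →L[ℂ] K} (hR : IsResolventAt T z R) (h : ‖(w - z) • R‖ < 1) : InResolventSet T w := by
  -- Neumann series: T - w = (1 - (w - z)R)(T - z).
  let u := Units.oneSub ((w - z) • R) h
  let Q : K →L[ℂ] K := (↑u⁻¹ : K →L[ℂ] K)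
  have hu : ∀ y, (u : K →L[ℂ] K) y = y - (w - z) • R y := fun y => rfl
  have hQ1 : ∀ y, Q ((u : K →L[ℂ] K) y) = y := fun y => by
    have := DFunLike.congr_fun u.inv_mul y
    exact this
  have hQ2 : ∀ y, (u : K →L[ℂ] K) (Q y) = y := fun y => by
    have := DFunLike.congr_fun u.mul_inv y
    exact this
  refine ⟨R * Q, fun x => ?_, fun y => ?_⟩
  · have h1 : T x - w • (x : K) = (u : K →L[ℂ] K) (T x - z • (x : K)) := by
      rw [hu, hR.1, sub_smul]
      abel
    rw [h1]
    exact (congrArg R (hQ1 _)).trans (hR.1 x)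
  · obtain ⟨hy, hy'⟩ := hR.2 (Q y)
    refine ⟨hy, ?_⟩
    have h2 := hQ2 y
    rw [hu] at h2
    calc T ⟨R (Q y), hy⟩ - w • R (Q y)
        = (T ⟨R (Q y), hy⟩ - z • R (Q y)) - (w - z) • R (Q y) := by rw [sub_smul]; abel
      _ = y := by rw [hy', h2]

/-- The resolvent identity. -/
theorem IsResolventAt.resolvent_identity {T : K →ₗ.[ℂ] K} {z w : ℂ} {R S : K →L[ℂ] K}
    (hR : IsResolventAt T z R) (hS : IsResolventAt T w S) : R - S = (z - w) • (R * S) := by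
  ext y
  obtain ⟨hy, hy'⟩ := hS.2 y
  have h1 := hR.1 ⟨S y, hy⟩
  have h2 : T ⟨S y, hy⟩ = y + w • S y := by nth_rw 2 [← hy']; abel
  rw [h2] at h1
  simp only [map_sub, map_add, map_smul] at h1
  change R y - S y = (z - w) • R (S y)
  calc R y - S y = R y - (R y + w • R (S y) - z • R (S y)) := by rw [h1]
    _ = _ := by rw [sub_smul]; abel

/-- With k = w - z, formally k⁻¹ - R = k⁻¹(T - w)R, so the inverse is k(T - z)S = k(1 + kS); the
resolvent identity verifies this. Points of the resolvent set of `T` thereby become points of the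
resolvent set of the bounded operator `R`. -/
theorem IsResolventAt.isUnit_algebraMap_sub {T : K →ₗ.[ℂ] K} {z w : ℂ} {R S : K →L[ℂ] K}
    (hR : IsResolventAt T z R) (hS : IsResolventAt T w S) (h : w ≠ z) :
    IsUnit (algebraMap ℂ (K →L[ℂ] K) (w - z)⁻¹ - R) := by
  have h0 : w - z ≠ 0 := sub_ne_zero.2 h
  have e1 := hR.resolvent_identity hS
  have e2 := hS.resolvent_identity hR
  rw [← neg_sub w z] at e1
  generalize w - z = k at *
  rw [isUnit_iff_exists, Algebra.algebraMap_eq_smul_one]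
  refine ⟨k • (1 + k • S), ?_, ?_⟩
  · have h1 : (k⁻¹ • (1 : K →L[ℂ] K) - R) * (k • (1 + k • S)) =
        (k * k⁻¹) • (1 + k • S) - k • (R - S + S) - (k * k) • (R * S) := by
      simp only [sub_mul, mul_add, smul_mul_assoc, mul_smul_comm, one_mul, mul_one, sub_add_cancel]
      module
    rw [h1, e1, mul_inv_cancel₀ h0]
    module
  · have h1 : (k • (1 + k • S)) * (k⁻¹ • (1 : K →L[ℂ] K) - R) =
        (k * k⁻¹) • (1 + k • S) - k • (S - (S - R)) - (k * k) • (S * R) := by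
      simp only [mul_sub, add_mul, smul_mul_assoc, mul_smul_comm, one_mul, mul_one, sub_sub_cancel]
      module
    rw [h1, e2, mul_inv_cancel₀ h0]
    module

end Resolvents

/-! ### Generators of unitary groups -/

section UnitaryGroups

open Filter Topology

variable {K : Type v} [NormedAddCommGroup K] [InnerProductSpace ℂ K]

local notation "⟪" x ", " y "⟫" => inner ℂ x y

/-- `W` is a one-parameter group of isometries, and `T = i d/dt|₀ W(t)` on the dense invariant
domain of `T`. -/
structure IsInvariantGenerator (W : ℝ → K →L[ℂ] K) (T : K →ₗ.[ℂ] K) : Prop where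
  map_zero : ∀ v, W 0 v = v
  map_add : ∀ s t v, W (s + t) v = W s (W t v)
  inner_map : ∀ t v w, ⟪W t v, W t w⟫ = ⟪v, w⟫
  dense : Dense (T.domain : Set K)
  mem_domain : ∀ t, ∀ v ∈ T.domain, W t v ∈ T.domain
  hasDerivAt : ∀ v : T.domain, HasDerivAt (fun t => W t v) (-Complex.I • T v) 0

namespace IsInvariantGenerator

variable {W : ℝ → K →L[ℂ] K} {T : K →ₗ.[ℂ] K} (h : IsInvariantGenerator W T)
include h

/-- The inner product ⟪W t x, W t y⟫ is constant in `t`; its derivative at 0 gives symmetry. -/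
theorem isFormalAdjoint : T.IsFormalAdjoint T := by
  intro x y
  have h1 := (h.hasDerivAt x).inner ℂ (h.hasDerivAt y)
  simp only [h.inner_map, h.map_zero] at h1
  have h2 := h1.unique (hasDerivAt_const _ _)
  rw [inner_smul_left, inner_smul_right] at h2
  simp only [map_neg, Complex.conj_I, neg_neg] at h2
  have h3 : Complex.I * (⟪T x, (y : K)⟫ - ⟪(x : K), T y⟫) = 0 := by rw [← h2]; ring
  exact sub_eq_zero.1 ((mul_eq_zero.1 h3).resolve_left Complex.I_ne_zero)

theorem isClosable [CompleteSpace K] : T.IsClosable :=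
  (LinearPMap.adjoint_isClosed h.dense).isClosable.leIsClosable
    (h.isFormalAdjoint.le_adjoint h.dense)

theorem norm_map (t : ℝ) (v : K) : ‖W t v‖ = ‖v‖ := by
  rw [← sq_eq_sq₀ (norm_nonneg _) (norm_nonneg _), ← inner_self_eq_norm_sq (𝕜 := ℂ),
    ← inner_self_eq_norm_sq (𝕜 := ℂ), h.inner_map]

theorem hasDerivAt_orbit (v : T.domain) (t : ℝ) :
    HasDerivAt (fun t => W t v) (-Complex.I • T ⟨W t v, h.mem_domain t v v.2⟩) t := by
  have h1 := h.hasDerivAt ⟨W t v, h.mem_domain t v v.2⟩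
  rw [hasDerivAt_iff_tendsto_slope_zero] at h1 ⊢
  refine h1.congr fun r => ?_
  rw [zero_add, ← h.map_add, ← h.map_add, zero_add, add_comm]

/-- Invariance of the domain is decisive. If `w` is orthogonal to the range, ⟪w, W t v⟫ solves a
scalar linear equation for every `v` in the domain, with a solution that grows exponentially in one
time direction unless it vanishes, whereas unitarity keeps it bounded. -/
theorem dense_range_sub [CompleteSpace K] {z : ℂ} (hz : z.im ≠ 0) :
    Dense (Set.range fun x : T.domain => T x - z • (x : K)) := by
  let S : T.domain →ₗ[ℂ] K := T.toFun - z • T.domain.subtype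
  have hS : Dense ((LinearMap.range S : Submodule ℂ K) : Set K) := by
    rw [Submodule.dense_iff_topologicalClosure_eq_top,
      Submodule.topologicalClosure_eq_top_iff, Submodule.eq_bot_iff]
    intro w hw
    have hw' : ∀ x : T.domain, ⟪w, T x⟫ = z * ⟪w, (x : K)⟫ := by
      intro x
      have h1 := (Submodule.mem_orthogonal' _ _).1 hw (S x) ⟨x, rfl⟩
      have h2 : S x = T x - z • (x : K) := rfl
      rwa [h2, inner_sub_right, inner_smul_right, sub_eq_zero] at h1
    have key : ∀ v ∈ T.domain, ⟪w, v⟫ = 0 := by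
      intro v hv
      have hder : ∀ t : ℝ, HasDerivAt
          (fun t : ℝ => Complex.exp (Complex.I * z * t) * ⟪w, W t v⟫) 0 t := by
        intro t
        have h1 := (hasDerivAt_const t w).inner ℂ (h.hasDerivAt_orbit ⟨v, hv⟩ t)
        have h2 : HasDerivAt (fun t : ℝ => Complex.exp (Complex.I * z * t))
            (Complex.exp (Complex.I * z * t) * (Complex.I * z)) t := by
          have := ((hasDerivAt_id (t : ℂ)).const_mul (Complex.I * z)).cexp.comp_ofReal
          simpa using this
        convert! h2.mul h1 using 1
        rw [inner_smul_right, hw', inner_zero_left]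
        ring
      have hconst : ∀ t : ℝ, Complex.exp (Complex.I * z * t) * ⟪w, W t v⟫ = ⟪w, v⟫ := by
        intro t
        have h1 := is_const_of_deriv_eq_zero (fun t => (hder t).differentiableAt)
          (fun t => (hder t).deriv) t 0
        simpa [h.map_zero] using h1
      have hbound : ∀ t : ℝ, ‖⟪w, v⟫‖ ≤ Real.exp (-z.im * t) * (‖w‖ * ‖v‖) := by
        intro t
        rw [← hconst t, norm_mul, Complex.norm_exp]
        have h3 : (Complex.I * z * t).re = -z.im * t := by simp
        rw [h3]
        gcongr
        exact (norm_inner_le_norm _ _).trans_eq (by rw [h.norm_map])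
      -- The time `z.im * n` selects the direction of decay for either sign of `z.im`, the exponent
      -- being -(z.im)² n.
      have hlim : Tendsto (fun n : ℝ => Real.exp (-z.im * (z.im * n)) * (‖w‖ * ‖v‖)) atTop
          (𝓝 0) := by
        rw [← zero_mul (‖w‖ * ‖v‖)]
        refine Tendsto.mul_const _ (Real.tendsto_exp_atBot.comp ?_)
        have h4 : ∀ n : ℝ, -z.im * (z.im * n) = -(z.im ^ 2) * n := fun n => by ring
        simp only [h4]
        exact tendsto_id.const_mul_atTop_of_neg (by have := sq_pos_of_ne_zero hz; linarith)
      exact norm_le_zero_iff.1 (ge_of_tendsto' hlim fun n => hbound _)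
    have h5 : ∀ v : K, ⟪w, v⟫ = 0 := fun v => by
      have h6 : v ∈ closure (T.domain : Set K) := h.dense v
      exact closure_minimal (t := {v | ⟪w, v⟫ = 0}) key
        (isClosed_eq (by fun_prop) continuous_const) h6
    exact inner_self_eq_zero.1 (h5 w)
  exact hS

omit h in
theorem _root_.mul_norm_le_of_mul_sq_le {x y : K} {c : ℝ} (hxy : c * ‖x‖ ^ 2 ≤ ‖⟪x, y⟫‖) :
    c * ‖x‖ ≤ ‖y‖ := by
  rcases eq_or_ne x 0 with rfl | hx
  · simp
  · have h1 : 0 < ‖x‖ := norm_pos_iff.2 hx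
    have h2 := hxy.trans (norm_inner_le_norm x y)
    nlinarith

omit h in
theorem _root_.inner_self_sub_smul (x y : K) (z : ℂ) :
    ⟪x, y - z • x⟫ = ⟪x, y⟫ - z * ((‖x‖ ^ 2 : ℝ) : ℂ) := by
  rw [inner_sub_right, inner_smul_right, Complex.ofReal_pow]
  exact congrArg (fun a => ⟪x, y⟫ - z * a) (inner_self_eq_norm_sq_to_K x)

omit h in
-- The constant involves only the real part of `z`, so the bound survives moving `z` off the real
-- axis, where density of the range is available.
theorem _root_.LinearPMap.sub_mul_norm_le {M : ℝ} {x : T.domain}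
    (hx : ⟪(x : K), T x⟫.re ≤ M * ‖(x : K)‖ ^ 2) (z : ℂ) :
    (z.re - M) * ‖(x : K)‖ ≤ ‖T x - z • (x : K)‖ := by
  apply mul_norm_le_of_mul_sq_le
  refine le_trans ?_ ((neg_le_abs _).trans (Complex.abs_re_le_norm _))
  rw [inner_self_sub_smul, Complex.sub_re, Complex.re_mul_ofReal]
  linarith

theorem closure_isFormalAdjoint [CompleteSpace K] : T.closure.IsFormalAdjoint T.closure := by
  have h1 : ∀ (x : T.closure.domain) (y : T.domain), ⟪T.closure x, (y : K)⟫ = ⟪(x : K), T y⟫ :=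
    fun x y => h.isClosable.closure_induction (P := fun p => ⟪p.2, (y : K)⟫ = ⟪p.1, T y⟫)
      (isClosed_eq (by fun_prop) (by fun_prop)) (fun x => h.isFormalAdjoint x y) x
  exact fun x y => h.isClosable.closure_induction
    (P := fun p => ⟪T.closure x, p.1⟫ = ⟪(x : K), p.2⟫)
    (isClosed_eq (by fun_prop) (by fun_prop)) (fun y => h1 x y) y

theorem dense_range_closure_sub [CompleteSpace K] {z : ℂ} (hz : z.im ≠ 0) :
    Dense (Set.range fun x : T.closure.domain => T.closure x - z • (x : K)) := by
  refine (h.dense_range_sub hz).mono ?_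
  rintro _ ⟨x, rfl⟩
  refine ⟨⟨x, T.le_closure.1 x.2⟩, ?_⟩
  have := T.le_closure.2 (x := x) (y := ⟨x, T.le_closure.1 x.2⟩) rfl
  simp only [← this]

omit h in
theorem _root_.LinearPMap.IsFormalAdjoint.isSelfAdjoint_resolvent [CompleteSpace K]
    (hT : T.IsFormalAdjoint T) {r : ℝ} {R : K →L[ℂ] K} (hR : IsResolventAt T r R) :
    IsSelfAdjoint R := by
  rw [ContinuousLinearMap.isSelfAdjoint_iff_isSymmetric]
  intro x y
  change ⟪R x, y⟫ = ⟪x, R y⟫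
  obtain ⟨hx, hx'⟩ := hR.2 x
  obtain ⟨hy, hy'⟩ := hR.2 y
  nth_rw 2 [← hx']
  nth_rw 1 [← hy']
  rw [inner_sub_right, inner_sub_left, inner_smul_right, inner_smul_left, Complex.conj_ofReal,
    ← hT ⟨R x, hx⟩ ⟨R y, hy⟩]

/-- The spectrum of the closure is bounded above by `M` if and only if the numerical range is. -/
theorem forall_mem_operatorSpectrum_le_iff [CompleteSpace K] (M : ℝ) :
    (∀ t : ℝ, (t : ℂ) ∈ operatorSpectrum T.closure → t ≤ M) ↔
      ∀ v : T.domain, ⟪(v : K), T v⟫.re ≤ M * ‖(v : K)‖ ^ 2 := by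
  constructor
  · intro hM v
    -- Only points strictly above `M` are known to lie in the resolvent set; the bound at `M`
    -- follows in the limit.
    suffices H : ∀ r : ℝ, M < r → ⟪(v : K), T v⟫.re ≤ r * ‖(v : K)‖ ^ 2 by
      have h1 : Tendsto (fun r : ℝ => r * ‖(v : K)‖ ^ 2) (𝓝[>] M) (𝓝 (M * ‖(v : K)‖ ^ 2)) :=
        (tendsto_id.mul_const _).mono_left nhdsWithin_le_nhds
      exact ge_of_tendsto h1 (by filter_upwards [self_mem_nhdsWithin] with r hr using H r hr)
    intro r hr
    have hres : ∀ t : ℝ, M < t → InResolventSet T.closure t := fun t ht => by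
      by_contra h1
      exact absurd (hM t h1) (not_le.2 ht)
    obtain ⟨R, hR⟩ := hres r hr
    have hR : IsResolventAt T.closure r R := hR
    have hRsa := h.closure_isFormalAdjoint.isSelfAdjoint_resolvent hR
    -- A negative spectral value `k` of `-R` would correspond to the spectral point r - 1/k > r of
    -- the closure, and there is none.
    have hnonneg : 0 ≤ -R := by
      rw [StarOrderedRing.nonneg_iff_spectrum_nonneg (R := ℝ) _ hRsa.neg]
      intro k hk
      by_contra hk0
      rw [not_le] at hk0
      refine hk ?_
      obtain ⟨S, hS⟩ := hres (r + (-k)⁻¹) (by have := inv_pos.2 (neg_pos.2 hk0); linarith)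
      have hne : ((r + (-k)⁻¹ : ℝ) : ℂ) ≠ r := by
        intro h1
        have h2 := Complex.ofReal_injective h1
        have := inv_pos.2 (neg_pos.2 hk0)
        linarith
      have hu := (hR.isUnit_algebraMap_sub hS hne).neg
      have h3 : ((((r + (-k)⁻¹ : ℝ) : ℂ) - r)⁻¹) = ((-k : ℝ) : ℂ) := by
        push_cast
        rw [add_sub_cancel_left, inv_inv]
      rw [h3] at hu
      change IsUnit (algebraMap ℝ (K →L[ℂ] K) k - -R)
      convert hu using 1
      rw [neg_sub, sub_neg_eq_add, add_comm, sub_eq_add_neg]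
      congr 1
      rw [Complex.ofReal_neg, map_neg, neg_neg]
      rfl
    rw [ContinuousLinearMap.nonneg_iff_isPositive] at hnonneg
    let x : T.closure.domain := ⟨v, T.le_closure.1 v.2⟩
    have hx : T v = T.closure x := T.le_closure.2 rfl
    -- Positivity of `-R` is tested on (T - r)v, which `-R` sends to -v.
    have h4 := hnonneg.re_inner_nonneg_right (T.closure x - (r : ℂ) • (x : K))
    have h5 : (-R) (T.closure x - (r : ℂ) • (x : K)) = -(v : K) := by
      rw [neg_apply, hR.1]
    rw [h5, inner_neg_right, inner_sub_left, inner_smul_left, ← hx,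
      h.isFormalAdjoint v v] at h4
    have h6 : ⟪(x : K), (v : K)⟫ = ((‖(v : K)‖ ^ 2 : ℝ) : ℂ) := by
      rw [Complex.ofReal_pow]
      exact inner_self_eq_norm_sq_to_K (v : K)
    rw [h6, Complex.conj_ofReal, ← Complex.ofReal_mul] at h4
    simp only [RCLike.re_to_complex, Complex.neg_re, Complex.sub_re, Complex.ofReal_re] at h4
    linarith
  · intro hM t ht
    by_contra hlt
    rw [not_le] at hlt
    refine ht ?_
    have hc : 0 < t - M := sub_pos.2 hlt
    -- At this nonreal point the range is dense and ‖R‖ ≤ 1/(t - M). Its distance (t - M)/2 to `t`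
    -- is within reach of the Neumann series.
    let z : ℂ := ⟨t, (t - M) / 2⟩
    have hz : z.im ≠ 0 := (half_pos hc).ne'
    obtain ⟨R, hR, hRn⟩ := exists_isResolventAt_of_bound h.isClosable.closure_isClosed hc
      (z := z) (h.isClosable.closure_induction (P := fun p => (t - M) * ‖p.1‖ ≤ ‖p.2 - z • p.1‖)
        (isClosed_le (by fun_prop) (by fun_prop)) fun x => LinearPMap.sub_mul_norm_le (hM x) z)
      (h.dense_range_closure_sub hz)
    refine hR.inResolventSet_of_norm_lt ?_
    have h7 : ‖(t : ℂ) - z‖ = (t - M) / 2 := by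
      have : (t : ℂ) - z = ((-((t - M) / 2) : ℝ) : ℂ) * Complex.I := by
        apply Complex.ext <;> simp [z]
      rw [this, norm_mul, Complex.norm_I, mul_one, Complex.norm_real, norm_neg, Real.norm_eq_abs,
        abs_of_pos (half_pos hc)]
    rw [norm_smul, h7]
    calc (t - M) / 2 * ‖R‖ ≤ (t - M) / 2 * (t - M)⁻¹ := by gcongr
      _ = 1 / 2 := by field_simp
      _ < 1 := by norm_num

end IsInvariantGenerator

end UnitaryGroups

/-! ### The exponential map of an oscillator group -/

section OscillatorGroups

open Filter Topology

theorem HasCurveDerivAt.continuousAt {E : Type u} [AddCommGroup E] [Module ℝ E]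
    [TopologicalSpace E] [ContinuousAdd E] [ContinuousSMul ℝ E] {c : ℝ → E} {c' : E} {t : ℝ}
    (h : HasCurveDerivAt c c' t) : ContinuousAt c t := by
  have h1 : ContinuousAt (fun r : ℝ => c (t + r)) 0 := by
    rw [continuousAt_iff_punctured_nhds]
    simpa using h.tendsto
  have h2 : ContinuousAt (fun r : ℝ => c (t + (r - t))) t :=
    ContinuousAt.comp (f := fun r : ℝ => r - t) (g := fun r : ℝ => c (t + r))
      (by simpa using h1) (by fun_prop)
  simpa using h2

theorem HasCurveDerivAt.comp_add_left {E : Type u} [AddCommGroup E] [Module ℝ E]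
    [TopologicalSpace E] {c : ℝ → E} {c' : E} {t u : ℝ} (h : HasCurveDerivAt c c' (t + u)) :
    HasCurveDerivAt (fun r => c (t + r)) c' u :=
  Tendsto.congr (fun r => by rw [add_assoc]) h

theorem HasCurveDerivAt.comp_mul_left {E : Type u} [AddCommGroup E] [Module ℝ E]
    [TopologicalSpace E] [ContinuousSMul ℝ E] {c : ℝ → E} {c' : E} {k t : ℝ}
    (h : HasCurveDerivAt c c' (k * t)) :
    HasCurveDerivAt (fun r => c (k * r)) (k • c') t := by
  rcases eq_or_ne k 0 with rfl | hk
  · simpa using hasCurveDerivAt_const (c 0) t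
  · have h1 : Tendsto (fun r : ℝ => k * r) (𝓝[≠] 0) (𝓝[≠] 0) := by
      refine tendsto_nhdsWithin_iff.2 ⟨?_, ?_⟩
      · have : Tendsto (fun r : ℝ => k * r) (𝓝 0) (𝓝 (k * 0)) := tendsto_id.const_mul k
        rw [mul_zero] at this
        exact this.mono_left nhdsWithin_le_nhds
      · filter_upwards [self_mem_nhdsWithin] with r hr
        exact mul_ne_zero hk hr
    refine ((Tendsto.comp h h1).const_smul k).congr fun r => ?_
    simp only [Function.comp, mul_add, smul_smul]
    rw [mul_inv, ← mul_assoc, mul_inv_cancel₀ hk, one_mul]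

theorem hasCurveDerivAt_smul_const {E : Type u} [AddCommGroup E] [Module ℝ E]
    [TopologicalSpace E] (x : E) (t : ℝ) : HasCurveDerivAt (fun r : ℝ => r • x) x t := by
  refine (tendsto_const_nhds (x := x)).congr' ?_
  filter_upwards [self_mem_nhdsWithin] with r hr
  have hr' : r ≠ 0 := hr
  simp [add_smul, inv_smul_smul₀ hr']

namespace StandardOscillatorData

variable {H : Type v} [NormedAddCommGroup H] [InnerProductSpace ℂ H] [CompleteSpace H]
  (S : StandardOscillatorData H)

theorem U_zero : S.U 0 = 1 := by
  have h := S.map_add 0 0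
  rw [add_zero] at h
  exact left_eq_mul.1 h

theorem continuous_val : Continuous S.val := by
  have h1 : Continuous fun x : S.SmoothSpace => (fun k : ℕ =>
    iteratedDeriv k (fun t => (S.U t : H →L[ℂ] H) (S.val x)) 0) := continuous_induced_dom
  have h2 := (continuous_apply 0).comp h1
  refine h2.congr fun x => ?_
  simp [S.U_zero]

theorem val_injective : Function.Injective S.val := Subtype.val_injective

theorem A_apply {x : S.SmoothSpace} {w : H}
    (hw : HasDerivAt (fun t => (S.U t : H →L[ℂ] H) (S.val x)) w 0) :
    S.A ⟨S.val x, S.val_mem_domain x⟩ = -Complex.I • w := by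
  rw [← hw.deriv]
  rfl

end StandardOscillatorData

variable {V : Type u} [AddCommGroup V] [Module ℝ V] [TopologicalSpace V]
    {d : OscillatorData V} {H : Type v} [NormedAddCommGroup H] [InnerProductSpace ℂ H]
    [CompleteSpace H] {S : StandardOscillatorData H}

namespace OscillatorData

variable (d)

theorem continuous_γ : Continuous fun p : ℝ × V => d.γ p.1 p.2 := d.γ_smooth 0

/-- The continuous linear automorphism `γ(t)`. -/
def γCLM (t : ℝ) : V →L[ℝ] V :=
  ⟨d.γ t, d.continuous_γ.comp (Continuous.prodMk_right t)⟩

/-- The continuous linear functional `ω(x, ·)`. -/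
def ωCLM (x : V) : V →L[ℝ] ℝ :=
  ⟨d.ω x, d.ω_continuous.comp (Continuous.prodMk_right x)⟩

theorem γ_γ_neg (t : ℝ) (x : V) : d.γ t (d.γ (-t) x) = x := by
  rw [← LinearMap.comp_apply, ← d.γ_add, add_neg_cancel, d.γ_zero, LinearMap.id_apply]

theorem ω_γ_neg_left (t : ℝ) (x y : V) : d.ω (d.γ (-t) x) y = d.ω x (d.γ t y) := by
  rw [← d.ω_γ t, d.γ_γ_neg]

theorem continuous_γ_curve (s : ℝ) (x : V) : Continuous fun r : ℝ => d.γ (s * r) x :=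
  d.continuous_γ.comp (f := fun r : ℝ => (s * r, x)) (by fun_prop)

theorem ω_skew (x y : V) : d.ω x y = -d.ω y x := by
  have h := d.ω_self (x + y)
  simp only [map_add, LinearMap.add_apply, d.ω_self] at h
  linarith

/-- The primitive `t ↦ ∫₀ᵗ γ(s r) x dr`. -/
def primitive (s : ℝ) (x : V) (t : ℝ) : V := vectorIntegral (fun r => d.γ (s * r) x) 0 t

end OscillatorData

namespace StandardEmbedding

variable (e : StandardEmbedding d S)

/-- The inclusion of `V` in the Hilbert space `H`. -/
def toHilbert : V →L[ℝ] H := ⟨S.val ∘ₗ e.ι, S.continuous_val.comp e.continuous⟩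

theorem toHilbert_apply (x : V) : e.toHilbert x = S.val (e.ι x) := rfl

theorem toHilbert_injective : Function.Injective e.toHilbert :=
  S.val_injective.comp e.injective

/-- Here w = Dy = iAy in `H`, so Im⟨Ay, x⟩ = -Re⟨w, x⟩. The symplectic form thus extends to an
expression in `w` that is continuous for the norm. -/
theorem ω_eq_neg_re_inner {y w : V} (hy : HasCurveDerivAt (fun t => d.γ t y) w 0) (x : V) :
    d.ω y x = -(inner ℂ (e.toHilbert w) (e.toHilbert x)).re := by
  have h1 := hasCurveDerivAt_iff_hasDerivAt.1 (hy.map e.toHilbert)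
  simp only [toHilbert_apply, e.map_γ] at h1
  rw [← e.map_ω, StandardOscillatorData.ω, S.A_apply h1, inner_smul_right]
  have h2 := inner_re_symm (𝕜 := ℂ) (e.toHilbert w) (e.toHilbert x)
  simp only [RCLike.re_to_complex, toHilbert_apply] at h2 ⊢
  rw [h2]
  simp

include e

/-- Uniqueness of antiderivatives is inherited from `H` through the injective inclusion; it makes
the choice in `vectorIntegral` immaterial. -/
theorem eq_of_hasCurveDerivAt {B C : ℝ → V} {c : ℝ → V}
    (hB : ∀ t, HasCurveDerivAt B (c t) t) (hC : ∀ t, HasCurveDerivAt C (c t) t) (a b : ℝ) :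
    B b - B a = C b - C a := by
  apply e.toHilbert_injective
  have h : ∀ t, HasDerivAt (fun r => e.toHilbert (B r) - e.toHilbert (C r)) 0 t := fun t => by
    have := (hasCurveDerivAt_iff_hasDerivAt.1 ((hB t).map e.toHilbert)).sub
      (hasCurveDerivAt_iff_hasDerivAt.1 ((hC t).map e.toHilbert))
    rwa [sub_self] at this
  have h1 := is_const_of_deriv_eq_zero (fun t => (h t).differentiableAt) (fun t => (h t).deriv) b a
  simp only [map_sub]
  rw [sub_eq_sub_iff_sub_eq_sub]
  exact h1

theorem vectorIntegral_eq {B : ℝ → V} {c : ℝ → V}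
    (hB : ∀ t, HasCurveDerivAt B (c t) t) (a b : ℝ) : vectorIntegral c a b = B b - B a := by
  have h : ∃ B : ℝ → V, ∀ t, HasCurveDerivAt B (c t) t := ⟨B, hB⟩
  rw [vectorIntegral, dif_pos h]
  exact e.eq_of_hasCurveDerivAt h.choose_spec hB a b

variable [ContinuousSMul ℝ V]

theorem hasCurveDerivAt_primitive (s : ℝ) (x : V) (t : ℝ) :
    HasCurveDerivAt (d.primitive s x) (d.γ (s * t) x) t := by
  have h : ∃ B : ℝ → V, ∀ t, HasCurveDerivAt B (d.γ (s * t) x) t := by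
    -- Rescaling the given antiderivative divides by `s`; for s = 0 the integrand is constant.
    rcases eq_or_ne s 0 with rfl | hs
    · exact ⟨_, fun t => by simpa [d.γ_zero] using hasCurveDerivAt_smul_const x t⟩
    · obtain ⟨B, hB⟩ := d.γ_integral x
      refine ⟨fun t => s⁻¹ • B (s * t), fun t => ?_⟩
      have h1 := ((hB (s * t)).comp_mul_left).clm (s⁻¹ • ContinuousLinearMap.id ℝ V)
      simpa [smul_smul, mul_inv_cancel₀ hs] using h1
  obtain ⟨B, hB⟩ := h
  have h2 : d.primitive s x = fun t => -B 0 + B t := funext fun t => by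
    rw [OscillatorData.primitive, e.vectorIntegral_eq hB]
    abel
  rw [h2]
  exact (hB t).const_add _

theorem primitive_zero (s : ℝ) (x : V) : d.primitive s x 0 = 0 := by
  rw [OscillatorData.primitive, e.vectorIntegral_eq (e.hasCurveDerivAt_primitive s x), sub_self]

theorem hasDerivAt_ω_primitive (y : V) (s : ℝ) (x : V) (t : ℝ) :
    HasDerivAt (fun r => d.ω y (d.primitive s x r)) (d.ω y (d.γ (s * t) x)) t :=
  hasCurveDerivAt_iff_hasDerivAt.1 ((e.hasCurveDerivAt_primitive s x t).map (d.ωCLM y))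

theorem continuous_primitive [IsTopologicalAddGroup V] (s : ℝ) (x : V) : Continuous (d.primitive s x) :=
  continuous_iff_continuousAt.2 fun t => (e.hasCurveDerivAt_primitive s x t).continuousAt

theorem primitive_add (s : ℝ) (x : V) (t u : ℝ) :
    d.primitive s x (t + u) = d.primitive s x t + d.γ (s * t) (d.primitive s x u) := by
  have h1 := e.eq_of_hasCurveDerivAt (c := fun r => d.γ (s * (t + r)) x)
    (B := fun r => d.primitive s x (t + r))
    (C := fun r => d.primitive s x t + d.γ (s * t) (d.primitive s x r))
    (fun r => (e.hasCurveDerivAt_primitive s x (t + r)).comp_add_left)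
    (fun r => by
      have := ((e.hasCurveDerivAt_primitive s x r).clm (d.γCLM (s * t))).const_add
        (d.primitive s x t)
      rw [mul_add, d.γ_add]
      exact this) 0 u
  simp only [add_zero, e.primitive_zero, map_zero, sub_eq_iff_eq_add'] at h1
  rw [h1, add_sub_cancel_left]

theorem continuous_ω_primitive [IsTopologicalAddGroup V] (s : ℝ) (x : V) :
    Continuous fun r => d.ω (d.primitive s x r) (d.γ (s * r) x) :=
  d.ω_continuous.comp ((e.continuous_primitive s x).prodMk (d.continuous_γ_curve s x))

/-- The exponential map along a line, as a curve in terms of the primitive of `γ`. -/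
theorem exp_smul (t : ℝ) (a : ℝ × V × ℝ) : OscillatorGroup.exp d (t • a) =
    ⟨t * a.1 + (1 / 2) * ∫ r in (0 : ℝ)..t,
      d.ω (d.primitive a.2.2 a.2.1 r) (d.γ (a.2.2 * r) a.2.1),
      d.primitive a.2.2 a.2.1 t, t * a.2.2⟩ := by
  obtain ⟨z, x, s⟩ := a
  have hx : ∀ r : ℝ, HasCurveDerivAt (fun r => d.primitive s x (t * r)) (d.γ (t * s * r) (t • x)) r :=
    fun r => by
      have := (e.hasCurveDerivAt_primitive s x (t * r)).comp_mul_left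
      rwa [← mul_assoc, mul_comm s t, ← map_smul] at this
  have hin : ∀ r : ℝ, ∫ r' in (0 : ℝ)..1, d.ω (d.γ (t * s * r * r') (t • x))
      (d.γ (t * s * r) (t • x)) * r =
      t * d.ω (d.primitive s x (t * r)) (d.γ (s * (t * r)) x) := by
    intro r
    -- The weight `r` in the double integral is the inner derivative of r' ↦ t r r', so the inner
    -- integrand has an explicit antiderivative.
    have hder : ∀ r' : ℝ, HasDerivAt
        (fun r' => -d.ω (d.γ (t * s * r) (t • x)) (d.primitive s x (t * (r * r'))))
        (d.ω (d.γ (t * s * r * r') (t • x)) (d.γ (t * s * r) (t • x)) * r) r' := by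
      intro r'
      have h1 := ((hx (r * r')).comp_mul_left).map (d.ωCLM (d.γ (t * s * r) (t • x)))
      have h2 := (hasCurveDerivAt_iff_hasDerivAt.1 h1).neg
      convert! h2 using 1
      rw [d.ω_skew, mul_assoc _ r r', (d.ωCLM _).map_smul, smul_eq_mul]
      change _ = -(r * d.ω _ _)
      ring
    rw [intervalIntegral.integral_eq_sub_of_hasDerivAt (fun r' _ => hder r')]
    · rw [mul_one, mul_zero, mul_zero, e.primitive_zero, map_zero, d.ω_skew]
      rw [map_smul, map_smul, smul_eq_mul, ← mul_assoc s, mul_comm s t]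
      ring
    · refine Continuous.intervalIntegrable ?_ _ _
      exact (d.ω_continuous.comp ((d.continuous_γ.comp
        (f := fun r' : ℝ => (t * s * r * r', t • x)) (by fun_prop)).prodMk
        continuous_const)).mul continuous_const
  simp only [OscillatorGroup.exp, Prod.smul_mk, smul_eq_mul]
  ext
  · simp only [hin]
    rw [intervalIntegral.integral_const_mul,
      intervalIntegral.mul_integral_comp_mul_left
        (f := fun r => d.ω (d.primitive s x r) (d.γ (s * r) x)), mul_zero, mul_one]
  · simp only
    rw [e.vectorIntegral_eq hx, mul_one, mul_zero, e.primitive_zero, sub_zero]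
  · rfl

theorem hasDerivAt_integral_ω_primitive [IsTopologicalAddGroup V] (s : ℝ) (x : V) (t : ℝ) :
    HasDerivAt (fun t => ∫ r in (0 : ℝ)..t, d.ω (d.primitive s x r) (d.γ (s * r) x))
      (d.ω (d.primitive s x t) (d.γ (s * t) x)) t :=
  (e.continuous_ω_primitive s x).integral_hasStrictDerivAt 0 t |>.hasDerivAt

theorem exp_add_smul [IsTopologicalAddGroup V] (t u : ℝ) (a : ℝ × V × ℝ) : OscillatorGroup.exp d ((t + u) • a) =
    OscillatorGroup.exp d (t • a) * OscillatorGroup.exp d (u • a) := by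
  obtain ⟨z, x, s⟩ := a
  simp only [e.exp_smul, OscillatorGroup.mul_def]
  set F : ℝ → ℝ := fun t => ∫ r in (0 : ℝ)..t, d.ω (d.primitive s x r) (d.γ (s * r) x) with hF
  ext
  · simp only
    -- Constancy in `u`, with value F(t) at u = 0, is precisely the cocycle relation for the central
    -- coordinate.
    have hder : ∀ u, HasDerivAt
        (fun u => F (t + u) - F u - d.ω (d.γ (-(s * t)) (d.primitive s x t)) (d.primitive s x u))
        0 u := by
      intro u
      have h1 := ((e.hasDerivAt_integral_ω_primitive s x (t + u)).comp_const_add t u).sub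
        (e.hasDerivAt_integral_ω_primitive s x u)
      have h2 := h1.sub (e.hasDerivAt_ω_primitive (d.γ (-(s * t)) (d.primitive s x t)) s x u)
      convert! h2 using 1
      rw [e.primitive_add, mul_add s, d.γ_add, LinearMap.comp_apply, map_add,
        LinearMap.add_apply, d.ω_γ, d.ω_γ_neg_left]
      ring
    have h3 := is_const_of_deriv_eq_zero (fun t => (hder t).differentiableAt)
      (fun t => (hder t).deriv) u 0
    have h4 : F 0 = 0 := by simp [hF]
    simp only [add_zero, h4, sub_zero, e.primitive_zero, map_zero] at h3
    rw [d.ω_γ_neg_left] at h3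
    rw [mul_comm t s]
    change (t + u) * z + 1 / 2 * F (t + u) = t * z + 1 / 2 * F t + (u * z + 1 / 2 * F u) + _
    linarith
  · simp only
    rw [e.primitive_add, mul_comm s t]
  · simp only
    ring

theorem exp_zero (a : ℝ × V × ℝ) : OscillatorGroup.exp d ((0 : ℝ) • a) = 1 := by
  rw [e.exp_smul, e.primitive_zero, OscillatorGroup.one_def]
  simp

/-- For a smooth vector only this velocity matters: by the chain rule dπ(a)v is the differential of
the orbit map applied to `a`, hence linear and continuous in `a`. -/
theorem hasCurveDerivAt_exp_smul [IsTopologicalAddGroup V] (a : ℝ × V × ℝ) :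
    HasCurveDerivAt (fun t : ℝ => ((OscillatorGroup.exp d (t • a)).z,
      (OscillatorGroup.exp d (t • a)).x, (OscillatorGroup.exp d (t • a)).s)) a 0 := by
  obtain ⟨z, x, s⟩ := a
  simp only [e.exp_smul]
  refine HasCurveDerivAt.prodMk ?_ (HasCurveDerivAt.prodMk ?_ ?_)
  · have h := ((hasDerivAt_id (0 : ℝ)).mul_const z).add
      ((e.hasDerivAt_integral_ω_primitive s x 0).const_mul (1 / 2))
    rw [e.primitive_zero, map_zero, LinearMap.zero_apply, mul_zero, add_zero, one_mul] at h
    exact hasCurveDerivAt_iff_hasDerivAt.2 h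
  · simpa [d.γ_zero] using e.hasCurveDerivAt_primitive s x 0
  · exact hasCurveDerivAt_smul_const s 0

end StandardEmbedding

end OscillatorGroups

/-! ### Moment functionals of smooth vectors and the adjoint action -/

section MomentFunctionals

open Filter Topology

variable {V : Type u} [AddCommGroup V] [Module ℝ V] [TopologicalSpace V] {d : OscillatorData V}
  {K : Type v} [NormedAddCommGroup K] [InnerProductSpace ℂ K] [CompleteSpace K]
  (π : OscillatorGroup d →* unitary (K →L[ℂ] K))

local notation "⟪" x ", " y "⟫" => inner ℂ x y

theorem unitary_mul_apply (g h : OscillatorGroup d) (v : K) :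
    (π (g * h) : K →L[ℂ] K) v = (π g : K →L[ℂ] K) ((π h : K →L[ℂ] K) v) := by
  rw [map_mul]
  rfl

theorem unitary_one_apply (v : K) : (π 1 : K →L[ℂ] K) v = v := by
  rw [map_one]
  rfl

theorem unitary_inner_map (g : OscillatorGroup d) (v w : K) :
    ⟪(π g : K →L[ℂ] K) v, (π g : K →L[ℂ] K) w⟫ = ⟪v, w⟫ :=
  ContinuousLinearMap.inner_map_map_of_mem_unitary (π g).2 v w

variable [IsTopologicalAddGroup V] [ContinuousSMul ℝ V]

/-- The orbit map of π(g)v is that of `v` after right translation by `g`, which is smooth because γ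
is smooth and ω is continuous and bilinear. -/
theorem map_mem_smoothVectors (g : OscillatorGroup d) {v : K} (hv : v ∈ smoothVectors π) :
    (π g : K →L[ℂ] K) v ∈ smoothVectors π := by
  intro n
  have hγ : BastianiContDiff n fun p : ℝ × V × ℝ => d.γ p.2.2 g.x := by
    have := (d.γ_smooth n).comp_affine n
      (((ContinuousLinearMap.snd ℝ V ℝ).comp (.snd ℝ ℝ (V × ℝ))).prod
        (0 : (ℝ × V × ℝ) →L[ℝ] V)) (0, g.x)
    simpa using this
  have hx : BastianiContDiff n fun p : ℝ × V × ℝ => p.2.1 :=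
    bastianiContDiff_clm n ((ContinuousLinearMap.fst ℝ V ℝ).comp (.snd ℝ ℝ (V × ℝ)))
  have hs : BastianiContDiff n fun p : ℝ × V × ℝ => p.2.2 :=
    bastianiContDiff_clm n ((ContinuousLinearMap.snd ℝ V ℝ).comp (.snd ℝ ℝ (V × ℝ)))
  have hz : BastianiContDiff n fun p : ℝ × V × ℝ => p.1 :=
    bastianiContDiff_clm n (ContinuousLinearMap.fst ℝ ℝ (V × ℝ))
  have hω := (BastianiContDiff.bilinear d.ω d.ω_continuous n hx hγ).clm
    ((1 / 2 : ℝ) • ContinuousLinearMap.id ℝ ℝ) n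
  have hR := ((hz.add n (bastianiContDiff_const n g.z)).add n hω).prodMk n
    ((hx.add n hγ).prodMk n (hs.add n (bastianiContDiff_const n g.s)))
  refine (congrArg (BastianiContDiff n) (funext fun p => ?_)).mp ((hv n).comp n hR)
  rw [← unitary_mul_apply]
  rfl

theorem exists_orbit_differential {v : K} (hv : v ∈ smoothVectors π) :
    ∃ L : (ℝ × V × ℝ) →L[ℝ] K, ∀ (c : ℝ → ℝ × V × ℝ) (c' : ℝ × V × ℝ), c 0 = 0 →
      HasCurveDerivAt c c' 0 →
        HasDerivAt (fun t => (π ⟨(c t).1, (c t).2.1, (c t).2.2⟩ : K →L[ℂ] K) v) (L c') 0 := by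
  obtain ⟨L, hL⟩ := (hv 1).exists_differential 0
  exact ⟨L, fun c c' => hL c c' 0⟩

/-- The derivative at the identity of the orbit map of a smooth vector. -/
def orbitDifferential (v : smoothVectors π) : (ℝ × V × ℝ) →L[ℝ] K :=
  (exists_orbit_differential π v.2).choose

theorem hasDerivAt_orbit_curve (v : smoothVectors π) {c : ℝ → ℝ × V × ℝ} {c' : ℝ × V × ℝ}
    (h0 : c 0 = 0) (hc : HasCurveDerivAt c c' 0) :
    HasDerivAt (fun t => (π ⟨(c t).1, (c t).2.1, (c t).2.2⟩ : K →L[ℂ] K) v)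
      (orbitDifferential π v c') 0 :=
  (exists_orbit_differential π v.2).choose_spec c c' h0 hc

/-- The functional `a ↦ ⟨i dπ(a) v, v⟩` on the Lie algebra. -/
def momentFunctional (v : smoothVectors π) : (ℝ × V × ℝ) →L[ℝ] ℝ :=
  Complex.reCLM.comp (((innerSL ℂ (Complex.I • (v : K))).restrictScalars ℝ).comp
    (-orbitDifferential π v))

theorem momentFunctional_apply (v : smoothVectors π) (a : ℝ × V × ℝ) :
    momentFunctional π v a = ⟪(v : K), Complex.I • orbitDifferential π v a⟫.re := by
  have h : momentFunctional π v a =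
    ⟪Complex.I • (v : K), -orbitDifferential π v a⟫.re := rfl
  rw [h, inner_smul_left, inner_smul_right, inner_neg_right]
  simp

variable {H : Type w₁} [NormedAddCommGroup H]
  [InnerProductSpace ℂ H] [CompleteSpace H] {S : StandardOscillatorData H}

section

variable (e : StandardEmbedding d S)
include e

theorem hasDerivAt_exp_orbit (v : smoothVectors π) (a : ℝ × V × ℝ) :
    HasDerivAt (fun t : ℝ => (π (OscillatorGroup.exp d (t • a)) : K →L[ℂ] K) v)
      (orbitDifferential π v a) 0 := by
  refine hasDerivAt_orbit_curve π v ?_ (e.hasCurveDerivAt_exp_smul a)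
  simp only [e.exp_zero]
  rfl

theorem mem_derivedRep_domain_iff (a : ℝ × V × ℝ) (v : K) :
    v ∈ (derivedRep π a).domain ↔ v ∈ smoothVectors π :=
  ⟨fun h => h.1, fun h => ⟨h, (hasDerivAt_exp_orbit π e ⟨v, h⟩ a).differentiableAt⟩⟩

theorem derivedRep_apply (a : ℝ × V × ℝ) (v : (derivedRep π a).domain) :
    derivedRep π a v = orbitDifferential π ⟨v, v.2.1⟩ a :=
  (hasDerivAt_exp_orbit π e ⟨v, v.2.1⟩ a).deriv

theorem isInvariantGenerator_derivedRep (hπ : IsSmoothRep π) (a : ℝ × V × ℝ) :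
    IsInvariantGenerator (fun t : ℝ => (π (OscillatorGroup.exp d (t • a)) : K →L[ℂ] K))
      (Complex.I • derivedRep π a) where
  map_zero v := by rw [e.exp_zero, unitary_one_apply]
  map_add s t v := by rw [e.exp_add_smul, unitary_mul_apply]
  inner_map t v w := unitary_inner_map π _ v w
  dense := hπ.mono fun v hv => (mem_derivedRep_domain_iff π e a v).2 hv
  mem_domain t v hv := (mem_derivedRep_domain_iff π e a _).2 (map_mem_smoothVectors π _ hv.1)
  hasDerivAt v := by
    convert! hasDerivAt_exp_orbit π e ⟨v, v.2.1⟩ a using 1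
    rw [← derivedRep_apply π e a v, LinearPMap.smul_apply, smul_smul]
    simp

/-- The support function is the supremum of the moment functionals of unit vectors. -/
theorem supportFunction_le_iff (hπ : IsSmoothRep π) (a : ℝ × V × ℝ) (M : ℝ) :
    supportFunction π a ≤ (M : EReal) ↔
      ∀ v : smoothVectors π, momentFunctional π v a ≤ M * ‖(v : K)‖ ^ 2 := by
  have h := (isInvariantGenerator_derivedRep π e hπ a).forall_mem_operatorSpectrum_le_iff M
  have h1 : supportFunction π a ≤ (M : EReal) ↔
      ∀ t : ℝ, (t : ℂ) ∈ operatorSpectrum (Complex.I • derivedRep π a).closure → t ≤ M := by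
    rw [supportFunction, sSup_le_iff]
    exact ⟨fun h t ht => EReal.coe_le_coe_iff.1 (h _ ⟨t, rfl, ht⟩),
      fun h r ⟨t, hr, ht⟩ => hr ▸ EReal.coe_le_coe_iff.2 (h t ht)⟩
  rw [h1, h]
  refine ⟨fun h2 v => ?_, fun h2 v => ?_⟩
  · have h3 := h2 ⟨v, (mem_derivedRep_domain_iff π e a v).2 v.2⟩
    rw [LinearPMap.smul_apply, derivedRep_apply π e] at h3
    rwa [momentFunctional_apply]
  · have h3 := h2 ⟨v, v.2.1⟩
    rwa [momentFunctional_apply, ← derivedRep_apply π e a v] at h3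

end

/-- The curve is the conjugate (0,y,0)(rt,rx,rs)(0,y,0)⁻¹, so its velocity is Ad(0,y,0)(t,x,s). A
coordinate line replaces the exponential curve since both have the same velocity at 0. -/
theorem hasCurveDerivAt_conj {y w : V} (hy : HasCurveDerivAt (fun t => d.γ t y) w 0)
    (t : ℝ) (x : V) (s : ℝ) :
    HasCurveDerivAt (fun r : ℝ => (r * t + (1 / 2) * d.ω y (r • x)
        + (1 / 2) * d.ω (y + r • x) (-d.γ (s * r) y), y + r • x + -d.γ (s * r) y, r * s))
      (t + d.ω y x + s / 2 * d.ω w y, x - s • w, s) 0 := by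
  have hγ : HasCurveDerivAt (fun r : ℝ => -d.γ (s * r) y) (-(s • w)) 0 := by
    have hy' : HasCurveDerivAt (fun t => d.γ t y) w (s * 0) := by rwa [mul_zero]
    have := hy'.comp_mul_left.clm (-ContinuousLinearMap.id ℝ V)
    simpa using this
  have hx := hasCurveDerivAt_smul_const x (0 : ℝ)
  have hyx := hx.const_add y
  refine HasCurveDerivAt.prodMk ?_ (HasCurveDerivAt.prodMk ?_ (hasCurveDerivAt_smul_const s 0))
  · have h1 := hyx.bilinear d.ω d.ω_continuous hγ
    have h2 := hx.map (d.ωCLM y)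
    have h3 := (((hasDerivAt_id (0 : ℝ)).mul_const t).add
      ((hasCurveDerivAt_iff_hasDerivAt.1 h2).const_mul (1 / 2))).add
      ((hasCurveDerivAt_iff_hasDerivAt.1 h1).const_mul (1 / 2))
    refine hasCurveDerivAt_iff_hasDerivAt.2 ?_
    convert! h3 using 1
    change _ = 1 * t + 1 / 2 * d.ω y x + _
    simp only [mul_zero, d.γ_zero, LinearMap.id_apply, zero_smul, add_zero, map_neg, map_smul,
      smul_eq_mul]
    rw [d.ω_skew w y, d.ω_skew x y]
    ring
  · rw [sub_eq_add_neg]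
    exact hyx.add hγ

/-- The moment functionals are equivariant with respect to the adjoint action of `V`. -/
theorem momentFunctional_conj {y w : V} (hy : HasCurveDerivAt (fun t => d.γ t y) w 0)
    (v : smoothVectors π) (t : ℝ) (x : V) (s : ℝ) :
    momentFunctional π v (t + d.ω y x + s / 2 * d.ω w y, x - s • w, s) =
      momentFunctional π ⟨(π (⟨0, y, 0⟩ : OscillatorGroup d)⁻¹ : K →L[ℂ] K) v,
        map_mem_smoothVectors π _ v.2⟩ (t, x, s) := by
  set g : OscillatorGroup d := ⟨0, y, 0⟩ with hg
  set v' : smoothVectors π := ⟨(π g⁻¹ : K →L[ℂ] K) v, map_mem_smoothVectors π _ v.2⟩ with hv'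
  have h1 := hasDerivAt_orbit_curve π v' (c := fun r : ℝ => r • (t, x, s)) (zero_smul _ _)
    (hasCurveDerivAt_smul_const _ 0)
  have h2 := ((π g : K →L[ℂ] K).restrictScalars ℝ).hasFDerivAt.comp_hasDerivAt (0 : ℝ) h1
  have h3 := hasDerivAt_orbit_curve π v (by simp [d.γ_zero, d.ω_self]) (hasCurveDerivAt_conj hy t x s)
  have h4 : (π g : K →L[ℂ] K) (orbitDifferential π v' (t, x, s)) = orbitDifferential π v
      (t + d.ω y x + s / 2 * d.ω w y, x - s • w, s) := by
    refine h2.unique (h3.congr_of_eventuallyEq (Eventually.of_forall fun r => ?_))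
    change (π g : K →L[ℂ] K) ((π _ : K →L[ℂ] K) ((π g⁻¹ : K →L[ℂ] K) v)) = _
    rw [← unitary_mul_apply, ← unitary_mul_apply]
    congr 3
    simp [hg, OscillatorGroup.mul_def, OscillatorGroup.inv_def, d.γ_zero, mul_comm r s]
  rw [momentFunctional_apply, momentFunctional_apply, ← h4, ← map_smul]
  have h5 : (v : K) = (π g : K →L[ℂ] K) v' := by
    change (v : K) = (π g : K →L[ℂ] K) ((π g⁻¹ : K →L[ℂ] K) v)
    rw [← unitary_mul_apply, mul_inv_cancel, unitary_one_apply]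
  rw [h5, unitary_inner_map]

end MomentFunctionals

/-! ### Invariance and continuity of the support function -/

section SupportFunctions

open Filter Topology

theorem EReal.le_of_forall_le_coe {a b : EReal} (h : ∀ M : ℝ, b ≤ (M : EReal) → a ≤ M) :
    a ≤ b := by
  induction b with
  | bot =>
    refine le_of_eq (EReal.eq_bot_iff_forall_lt a |>.2 fun M => ?_)
    exact (h (M - 1) bot_le).trans_lt (EReal.coe_lt_coe_iff.2 (by linarith))
  | coe r => exact h r le_rfl
  | top => exact le_top

theorem eq_zero_of_forall_add_mul_le {A u C : ℝ} (h : ∀ r : ℝ, A + r * u ≤ C) : u = 0 := by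
  by_contra hu
  have := h ((C - A + 1) / u)
  rw [div_mul_cancel₀ _ hu] at this
  linarith

/-- An extended real valued supremum of linear functionals on a finite-dimensional space is
continuous in the interior of its domain. -/
theorem continuousAt_of_le_iff {E : Type*} [NormedAddCommGroup E] [NormedSpace ℝ E]
    [FiniteDimensional ℝ E] {ι : Type*} {ℓ : ι → E → ℝ}
    (hadd : ∀ j x y, ℓ j (x + y) = ℓ j x + ℓ j y) (hsmul : ∀ j (r : ℝ) x, ℓ j (r • x) = r * ℓ j x)
    {c : ι → ℝ} {j₀ : ι} (hj₀ : 0 < c j₀)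
    {g : E → EReal} (hg : ∀ a (M : ℝ), g a ≤ (M : EReal) ↔ ∀ j, ℓ j a ≤ M * c j)
    {a : E} (ha : ∀ᶠ b in 𝓝 a, g b < ⊤) : ContinuousAt g a := by
  obtain ⟨δ, hδ, hball⟩ := Metric.eventually_nhds_iff_ball.1 ha
  -- The index `j₀` with positive weight excludes the value -∞, so the function is real-valued,
  -- convex and therefore continuous on the ball.
  have hbot : ∀ b, g b ≠ ⊥ := by
    intro b hb
    have h1 : ∀ M : ℝ, ℓ j₀ b ≤ M * c j₀ := fun M => (hg b M).1 (hb ▸ bot_le) j₀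
    have h2 := h1 (ℓ j₀ b / c j₀ - 1)
    rw [sub_mul, div_mul_cancel₀ _ hj₀.ne'] at h2
    linarith
  have hcoe : ∀ b ∈ Metric.ball a δ, ((g b).toReal : EReal) = g b := fun b hb =>
    EReal.coe_toReal (hball b hb).ne (hbot b)
  have hconv : ConvexOn ℝ (Metric.ball a δ) fun b => (g b).toReal := by
    refine ⟨convex_ball a δ, fun x hx y hy p q hp hq hpq => ?_⟩
    have hxy := convex_ball a δ hx hy hp hq hpq
    rw [← EReal.coe_le_coe_iff, hcoe _ hxy, hg]
    intro j
    have h1 := (hg x _).1 (hcoe x hx).ge j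
    have h2 := (hg y _).1 (hcoe y hy).ge j
    rw [hadd, hsmul, hsmul, smul_eq_mul, smul_eq_mul, add_mul, mul_assoc, mul_assoc]
    gcongr
  have hcont := (hconv.continuousOn Metric.isOpen_ball).continuousAt (Metric.ball_mem_nhds a hδ)
  have h3 : ContinuousAt (fun b => ((g b).toReal : EReal)) a :=
    continuous_coe_real_ereal.continuousAt.comp hcont
  refine h3.congr ?_
  filter_upwards [Metric.ball_mem_nhds a hδ] with b hb using hcoe b hb

variable {V : Type u} [AddCommGroup V] [Module ℝ V] [TopologicalSpace V]
  [IsTopologicalAddGroup V] [ContinuousSMul ℝ V] {d : OscillatorData V}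
  {K : Type v} [NormedAddCommGroup K] [InnerProductSpace ℂ K] [CompleteSpace K]
  {π : OscillatorGroup d →* unitary (K →L[ℂ] K)} (hπ : IsSmoothRep π)
  {H : Type w₁} [NormedAddCommGroup H] [InnerProductSpace ℂ H] [CompleteSpace H]
  {S : StandardOscillatorData H} (e : StandardEmbedding d S)

include e hπ

theorem supportFunction_eq_of_forall {a b : ℝ × V × ℝ}
    (h : ∀ v : smoothVectors π, momentFunctional π v a = momentFunctional π v b) :
    supportFunction π a = supportFunction π b := by
  refine le_antisymm (EReal.le_of_forall_le_coe fun M hM => ?_)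
    (EReal.le_of_forall_le_coe fun M hM => ?_) <;>
  · rw [supportFunction_le_iff π e hπ] at hM ⊢
    simpa only [h] using hM

/-- Elements in the closure of an adjoint orbit have smaller support function. -/
theorem supportFunction_conj_le (hD : Dense d.rangeD) (t : ℝ) (x : V) (s : ℝ) (w : V) :
    supportFunction π (t - (inner ℂ (e.toHilbert w) (e.toHilbert x)).re
      + s / 2 * ‖e.toHilbert w‖ ^ 2, x - s • w, s) ≤ supportFunction π (t, x, s) := by
  refine EReal.le_of_forall_le_coe fun M hM => ?_
  rw [supportFunction_le_iff π e hπ] at hM ⊢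
  intro v
  have hclosed : IsClosed {w : V | momentFunctional π v
      (t - (inner ℂ (e.toHilbert w) (e.toHilbert x)).re + s / 2 * ‖e.toHilbert w‖ ^ 2,
        x - s • w, s) ≤ M * ‖(v : K)‖ ^ 2} := by
    refine isClosed_le ((momentFunctional π v).continuous.comp ?_) continuous_const
    have h1 : Continuous fun w => (inner ℂ (e.toHilbert w) (e.toHilbert x)).re :=
      Complex.continuous_re.comp (e.toHilbert.continuous.inner continuous_const)
    have h2 : Continuous fun w => ‖e.toHilbert w‖ := e.toHilbert.continuous.norm
    fun_prop
  -- For each fixed `v` the condition on `w` is closed, so it suffices to check w = Dy, where it is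
  -- the bound for the vector π(0,y,0)⁻¹v of the same norm.
  refine closure_minimal ?_ hclosed (hD w)
  rintro w ⟨y, hy⟩
  have h3 := momentFunctional_conj π hy v t x s
  have h4 : d.ω w y = ‖e.toHilbert w‖ ^ 2 := by
    rw [d.ω_skew, e.ω_eq_neg_re_inner hy, neg_neg]
    exact inner_self_eq_norm_sq (𝕜 := ℂ) (e.toHilbert w)
  rw [e.ω_eq_neg_re_inner hy, h4, ← sub_eq_add_neg] at h3
  have h5 := hM ⟨_, map_mem_smoothVectors π (⟨0, y, 0⟩ : OscillatorGroup d)⁻¹ v.2⟩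
  rw [← h3] at h5
  refine h5.trans_eq ?_
  have h6 : ‖(π (⟨0, y, 0⟩ : OscillatorGroup d)⁻¹ : K →L[ℂ] K) v‖ = ‖(v : K)‖ :=
    ContinuousLinearMap.norm_map_of_mem_unitary (π _).2 _
  rw [h6]

/-- The support function off the hyperplane `s = 0`. -/
theorem supportFunction_eq_sub_norm_sq (hD : Dense d.rangeD) (t : ℝ) (x : V) {s : ℝ} (hs : s ≠ 0) :
    supportFunction π (t, x, s) =
      supportFunction π (t - ‖e.toHilbert x‖ ^ 2 / (2 * s), 0, s) := by
  have hinner : (inner ℂ (e.toHilbert x) (e.toHilbert x)).re = ‖e.toHilbert x‖ ^ 2 :=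
    inner_self_eq_norm_sq (𝕜 := ℂ) (e.toHilbert x)
  apply le_antisymm
  · have h := supportFunction_conj_le hπ e hD (t - ‖e.toHilbert x‖ ^ 2 / (2 * s)) 0 s (-(s⁻¹ • x))
    convert! h using 3
    · rw [map_zero, inner_zero_right, map_neg, map_smul, norm_neg, norm_smul, mul_pow,
        Real.norm_eq_abs, sq_abs, Complex.zero_re]
      field_simp
      ring
    · rw [smul_neg, smul_inv_smul₀ hs, sub_neg_eq_add, zero_add]
  · have h := supportFunction_conj_le hπ e hD t x s (s⁻¹ • x)
    convert! h using 3
    · rw [map_smul, norm_smul, mul_pow, Real.norm_eq_abs, sq_abs, inner_smul_left_eq_smul, Complex.smul_re,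
        hinner, smul_eq_mul]
      field_simp
      ring
    · rw [smul_inv_smul₀ hs, sub_self]

/-- If `B(I_π)` has an interior point with `s = 0`, then the support function only depends on the
outer coordinates. -/
theorem supportFunction_eq_zero_mid (hD : Dense d.rangeD) {t₀ : ℝ} {x₀ : V}
    (h₀ : (t₀, x₀, (0 : ℝ)) ∈ interior (boundedCone π)) (t : ℝ) (x : V) (s : ℝ) :
    supportFunction π (t, x, s) = supportFunction π (t, 0, s) := by
  rcases eq_or_ne x 0 with rfl | hx
  · rfl
  have hnhds : boundedCone π ∈ 𝓝 (t₀, x₀, (0 : ℝ)) := mem_interior_iff_mem_nhds.1 h₀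
  have hbound : ∀ a ∈ boundedCone π, ∃ C : ℝ, supportFunction π a ≤ C := fun a ha => by
    obtain ⟨C, hC, -⟩ := EReal.lt_iff_exists_real_btwn.1 (show supportFunction π a < ⊤ from ha)
    exact ⟨C, hC.le⟩
  -- a direction of `V` along which the center acts trivially
  have hcenter : ∀ v : smoothVectors π, momentFunctional π v (1, 0, 0) = 0 := by
    obtain ⟨x₁, hx₁, hB⟩ : ∃ x₁ : V, x₁ ≠ 0 ∧ (t₀, x₁, (0 : ℝ)) ∈ boundedCone π := by
      rcases eq_or_ne x₀ 0 with rfl | hx₀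
      · have hc : ContinuousAt (fun r : ℝ => (t₀, r • x, (0 : ℝ))) 0 := by fun_prop
        have h1 : ∀ᶠ r : ℝ in 𝓝[≠] 0, (t₀, r • x, (0 : ℝ)) ∈ boundedCone π :=
          nhdsWithin_le_nhds (hc (by simpa using hnhds))
        obtain ⟨r, hr, hr0⟩ := (h1.and self_mem_nhdsWithin).exists
        exact ⟨r • x, smul_ne_zero hr0 hx, hr⟩
      · exact ⟨x₀, hx₀, interior_subset h₀⟩
    obtain ⟨C, hC⟩ := hbound _ hB
    intro v
    have hN : ‖e.toHilbert x₁‖ ^ 2 ≠ 0 := by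
      refine pow_ne_zero 2 (norm_ne_zero_iff.2 fun h => hx₁ (e.toHilbert_injective ?_))
      rw [h, map_zero]
    -- At s = 0 the quadratic term disappears, and w = r x₁ moves the central coordinate by -r‖x₁‖²
    -- with `x₁` fixed. An affine function of `r` bounded above has slope zero.
    have h2 : ∀ r : ℝ, momentFunctional π v (t₀, x₁, 0) +
        r * (-(‖e.toHilbert x₁‖ ^ 2) * momentFunctional π v (1, 0, 0)) ≤ C * ‖(v : K)‖ ^ 2 := by
      intro r
      have h3 := (supportFunction_conj_le hπ e hD t₀ x₁ 0 (r • x₁)).trans hC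
      rw [supportFunction_le_iff π e hπ] at h3
      refine le_trans (le_of_eq ?_) (h3 v)
      have h4 : (inner ℂ (e.toHilbert x₁) (e.toHilbert x₁)).re = ‖e.toHilbert x₁‖ ^ 2 :=
        inner_self_eq_norm_sq (𝕜 := ℂ) (e.toHilbert x₁)
      rw [map_smul, inner_smul_left_eq_smul, Complex.smul_re, h4, zero_smul, sub_zero, zero_div,
        zero_mul, add_zero, smul_eq_mul, ← smul_eq_mul, ← smul_eq_mul, ← map_smul, ← map_smul,
        ← map_add]
      congr 1
      simp [sub_eq_add_neg]
    exact (mul_eq_zero.1 (eq_zero_of_forall_add_mul_le h2)).resolve_left (neg_ne_zero.2 hN)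
  have hshift : ∀ t t' x s, supportFunction π (t, x, s) = supportFunction π (t', x, s) := by
    intro t t' x s
    refine supportFunction_eq_of_forall hπ e fun v => ?_
    have h5 : (t, x, s) = (t', x, s) + (t - t') • ((1 : ℝ), (0 : V), (0 : ℝ)) := by simp
    rw [h5, map_add, map_smul, hcenter, smul_zero, add_zero]
  rcases eq_or_ne s 0 with rfl | hs
  · obtain ⟨δ, hδ, hB⟩ : ∃ δ : ℝ, δ ≠ 0 ∧ (t₀, x₀, δ) ∈ boundedCone π := by
      have hc : ContinuousAt (fun r : ℝ => (t₀, x₀, r)) 0 := by fun_prop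
      have h1 : ∀ᶠ r : ℝ in 𝓝[≠] 0, (t₀, x₀, r) ∈ boundedCone π := nhdsWithin_le_nhds (hc hnhds)
      obtain ⟨r, hr, hr0⟩ := (h1.and self_mem_nhdsWithin).exists
      exact ⟨r, hr0, hr⟩
    obtain ⟨C, hC⟩ := hbound _ hB
    refine supportFunction_eq_of_forall hπ e fun v => ?_
    have h6 : ∀ r : ℝ, momentFunctional π v (t, 0, δ) + r * momentFunctional π v (0, x, 0) ≤
        C * ‖(v : K)‖ ^ 2 := by
      intro r
      have h7 : supportFunction π (t, r • x, δ) ≤ C := by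
        rwa [supportFunction_eq_sub_norm_sq hπ e hD t _ hδ, hshift _
          (t₀ - ‖e.toHilbert x₀‖ ^ 2 / (2 * δ)), ← supportFunction_eq_sub_norm_sq hπ e hD t₀ _ hδ]
      rw [supportFunction_le_iff π e hπ] at h7
      refine le_trans (le_of_eq ?_) (h7 v)
      rw [← smul_eq_mul, ← map_smul, ← map_add]
      congr 1
      simp
    have h8 := eq_zero_of_forall_add_mul_le h6
    have h9 : (t, x, (0 : ℝ)) = (t, 0, 0) + (0, x, 0) := by simp
    rw [h9, map_add, h8, add_zero]
  · rw [supportFunction_eq_sub_norm_sq hπ e hD t x hs]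
    exact hshift _ _ _ _

omit e hπ [IsTopologicalAddGroup V] [ContinuousSMul ℝ V] in
theorem exists_smoothVector_norm_pos [Nontrivial K] (hπ : IsSmoothRep π) :
    ∃ v : smoothVectors π, 0 < ‖(v : K)‖ ^ 2 := by
  by_contra! h
  obtain ⟨k, hk⟩ := exists_ne (0 : K)
  refine hk ?_
  have h1 : (smoothVectors π : Set K) ⊆ {0} := fun v hv => by
    have h2 := h ⟨v, hv⟩
    have h3 : ‖v‖ ^ 2 = 0 := le_antisymm h2 (sq_nonneg _)
    simpa using h3
  exact closure_minimal h1 isClosed_singleton (hπ k)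

theorem continuousAt_supportFunction_plane [Nontrivial K] {b : ℝ × ℝ}
    (hb : ∀ᶠ c : ℝ × ℝ in 𝓝 b, supportFunction π (c.1, 0, c.2) < ⊤) :
    ContinuousAt (fun c : ℝ × ℝ => supportFunction π (c.1, 0, c.2)) b := by
  obtain ⟨v₀, hv₀⟩ := exists_smoothVector_norm_pos hπ
  refine continuousAt_of_le_iff (ι := smoothVectors π)
    (ℓ := fun v c => momentFunctional π v (c.1, 0, c.2)) (c := fun v => ‖(v : K)‖ ^ 2)
    (fun v x y => ?_) (fun v r x => ?_) hv₀ (fun a M => supportFunction_le_iff π e hπ _ M) hb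
  · rw [← map_add]
    simp
  · rw [← smul_eq_mul, ← map_smul]
    simp

/-- The support function is continuous for the norm topology at interior points of `B(I_π)`. -/
theorem tendsto_supportFunction_comap [Nontrivial K] (hD : Dense d.rangeD) {a : ℝ × V × ℝ}
    (ha : a ∈ interior (boundedCone π)) :
    Tendsto (supportFunction π)
      (comap (fun a : ℝ × V × ℝ => (a.1, e.toHilbert a.2.1, a.2.2))
        (𝓝 (a.1, e.toHilbert a.2.1, a.2.2))) (𝓝 (supportFunction π a)) := by
  obtain ⟨t, x, s⟩ := a
  have hnhds : boundedCone π ∈ 𝓝 (t, x, s) := mem_interior_iff_mem_nhds.1 ha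
  -- Near the point, s_π is to factor through a norm-continuous map θ into the plane x = 0, on which
  -- it is finite near the image point.
  suffices H : ∃ θ : ℝ × H × ℝ → ℝ × ℝ, ContinuousAt θ (t, e.toHilbert x, s) ∧
      (∀ᶠ p : ℝ × H × ℝ in 𝓝 (t, e.toHilbert x, s), ∀ y : V, e.toHilbert y = p.2.1 →
        supportFunction π (p.1, y, p.2.2) = supportFunction π ((θ p).1, 0, (θ p).2)) ∧
      ∀ᶠ c : ℝ × ℝ in 𝓝 (θ (t, e.toHilbert x, s)), supportFunction π (c.1, 0, c.2) < ⊤ by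
    obtain ⟨θ, hθ, hev, hfin⟩ := H
    have h1 := (continuousAt_supportFunction_plane hπ e hfin).comp hθ
    have h2 := Tendsto.comp h1 (tendsto_comap
      (f := fun a : ℝ × V × ℝ => (a.1, e.toHilbert a.2.1, a.2.2)))
    rw [hev.self_of_nhds x rfl]
    refine h2.congr' ?_
    filter_upwards [tendsto_comap.eventually hev] with b hb
    exact (hb b.2.1 rfl).symm
  rcases eq_or_ne s 0 with rfl | hs
  · refine ⟨fun p => (p.1, p.2.2), by fun_prop, Eventually.of_forall fun p y _ =>
      supportFunction_eq_zero_mid hπ e hD ha _ _ _, ?_⟩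
    have hc : ContinuousAt (fun c : ℝ × ℝ => (c.1, x, c.2)) (t, 0) := by fun_prop
    filter_upwards [hc hnhds] with c hc
    rw [← supportFunction_eq_zero_mid hπ e hD ha _ x]
    exact hc
  · refine ⟨fun p => (p.1 - ‖p.2.1‖ ^ 2 / (2 * p.2.2), p.2.2), ?_, ?_, ?_⟩
    · have : (2 * s) ≠ 0 := by simpa using hs
      fun_prop (disch := simpa using hs)
    · have h3 : ∀ᶠ p : ℝ × H × ℝ in 𝓝 (t, e.toHilbert x, s), p.2.2 ≠ 0 :=
        (continuousAt_snd.comp continuousAt_snd).eventually_ne hs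
      filter_upwards [h3] with p hp y hy
      rw [supportFunction_eq_sub_norm_sq hπ e hD _ _ hp, hy]
    · have hc : ContinuousAt (fun c : ℝ × ℝ => (c.1 + ‖e.toHilbert x‖ ^ 2 / (2 * c.2), x, c.2))
          (t - ‖e.toHilbert x‖ ^ 2 / (2 * s), s) := by
        fun_prop (disch := simpa using hs)
      have h4 : ∀ᶠ c : ℝ × ℝ in 𝓝 (t - ‖e.toHilbert x‖ ^ 2 / (2 * s), s), c.2 ≠ 0 :=
        continuousAt_snd.eventually_ne hs
      filter_upwards [hc (by simpa using hnhds), h4] with c hc hc2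
      have h5 : supportFunction π (c.1 + ‖e.toHilbert x‖ ^ 2 / (2 * c.2), x, c.2) < ⊤ := hc
      rwa [supportFunction_eq_sub_norm_sq hπ e hD _ _ hc2, add_sub_cancel_right] at h5

omit e in
theorem supportFunction_ne_bot [Nontrivial K] (e : StandardEmbedding d S) (a : ℝ × V × ℝ) :
    supportFunction π a ≠ ⊥ := by
  intro h
  obtain ⟨v, hv⟩ := exists_smoothVector_norm_pos hπ
  have h1 := (supportFunction_le_iff π e hπ a
    (momentFunctional π v a / ‖(v : K)‖ ^ 2 - 1)).1 (h ▸ bot_le) v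
  rw [sub_mul, div_mul_cancel₀ _ hv.ne'] at h1
  linarith

theorem isSemibounded_of_nonempty_interior [Nontrivial K] (hD : Dense d.rangeD)
    (h : (interior (boundedCone π)).Nonempty) : IsSemibounded π := by
  obtain ⟨a, ha⟩ := h
  have hlt : supportFunction π a < ⊤ := (interior_subset ha : a ∈ boundedCone π)
  -- The inclusion in `H` is continuous, so the norm topology is coarser and continuity transfers to
  -- the given topology.
  have hcont : ContinuousAt (supportFunction π) a := by
    refine (tendsto_supportFunction_comap hπ e hD ha).mono_left ?_
    rw [← map_le_iff_le_comap]
    have : Continuous fun a : ℝ × V × ℝ => (a.1, e.toHilbert a.2.1, a.2.2) := by fun_prop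
    exact this.continuousAt
  obtain ⟨m, hm⟩ : ∃ m : ℝ, supportFunction π a = m :=
    ⟨_, (EReal.coe_toReal hlt.ne (supportFunction_ne_bot hπ e a)).symm⟩
  have h1 : ((m - 1 : ℝ) : EReal) < supportFunction π a := by
    rw [hm, EReal.coe_lt_coe_iff]
    linarith
  have h2 : supportFunction π a < ((m + 1 : ℝ) : EReal) := by
    rw [hm, EReal.coe_lt_coe_iff]
    linarith
  obtain ⟨W, hW, hWo, haW⟩ := eventually_nhds_iff.1 (hcont.eventually (Ioo_mem_nhds h1 h2))
  refine ⟨W, hWo, ⟨a, haW⟩, |m| + 1, fun b hb => ?_⟩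
  obtain ⟨h3, h4⟩ := hW b hb
  have h5 := abs_le.1 (le_refl |m|)
  constructor
  · exact le_trans (EReal.coe_le_coe_iff.2 (by linarith)) h3.le
  · exact h4.le.trans (EReal.coe_le_coe_iff.2 (by linarith))

omit e hπ [IsTopologicalAddGroup V] [ContinuousSMul ℝ V] in
theorem IsSemibounded.nonempty_interior (h : IsSemibounded π) :
    (interior (boundedCone π)).Nonempty := by
  obtain ⟨W, hWo, hWn, C, hC⟩ := h
  refine hWn.mono (interior_maximal (fun a ha => ?_) hWo)
  exact (hC a ha).2.trans_lt (EReal.coe_lt_top C)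

end SupportFunctions

end

theorem proposition2p11
    {H : Type*} [NormedAddCommGroup H] [InnerProductSpace ℂ H] [CompleteSpace H] [Nontrivial H]
    (S : StandardOscillatorData H)
    {V : Type*} [AddCommGroup V] [Module ℝ V] [TopologicalSpace V] [IsTopologicalAddGroup V]
    [ContinuousSMul ℝ V] [LocallyConvexSpace ℝ V] [T2Space V]
    (d : OscillatorData V) (e : StandardEmbedding d S) (hD : Dense d.rangeD)
    {K : Type*} [NormedAddCommGroup K] [InnerProductSpace ℂ K] [CompleteSpace K] [Nontrivial K]
    (π : OscillatorGroup d →* unitary (K →L[ℂ] K)) (hπ : IsSmoothRep π) :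
    (∀ (t : ℝ) (x : V) (s : ℝ), s ≠ 0 →
      supportFunction π (t, x, s) =
        supportFunction π (t - ‖S.val (e.ι x)‖ ^ 2 / (2 * s), 0, s)) ∧
    @ContinuousOn (ℝ × V × ℝ) EReal e.normTopology inferInstance (supportFunction π)
      (interior (boundedCone π)) ∧
    (IsSemibounded π ↔ (interior (boundedCone π)).Nonempty) := by
  refine ⟨fun t x s hs => supportFunction_eq_sub_norm_sq hπ e hD t x hs, ?_,
    IsSemibounded.nonempty_interior, isSemibounded_of_nonempty_interior hπ e hD⟩
  intro a ha
  have h := tendsto_supportFunction_comap hπ e hD ha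
  -- Continuity holds along the full norm neighbourhood filter of `a`, including points outside the
  -- interior, since s_π takes extended real values.
  refine Filter.Tendsto.mono_left ?_ (@nhdsWithin_le_nhds _ e.normTopology a _)
  rw [nhds_induced]
  exact h
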